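/- Let $K$ be a unique factorization domain of characteristic $p>0$, let $1\le m\le n$, and let $f_1,\dots,f_m\in A=K[x_1,\dots,x_n]$ be arbitrary polynomials. Put $B=K[x_1^p,\dots,x_n^p]$, let $R_i=B[f_l : l\ne i]$ for $1\le i\le m$, and let $R_{ij}=B[f_l : l\ne i,j]$ for $i\neq j$. For $a,b\in A$ write $a\sim b$ if $a=ub$ for a unit $u$ of $A$. An element of $A$ is called square-free if it is not divisible by the square of any noninvertible element of $A$, and $B$-free if it is not divisible by any noninvertible element of $B$. Let $\operatorname{dgcd}(f_1,\dots,f_m)$ be the greatest common divisor in $A$ of all the jacobian determinants $\det\left[\frac{\partial f_a}{\partial x_{j_b}}\right]_{a,b=1,\dots,m}$ with $j_1,\dots,j_m\in\{1,\dots,n\}$ (it is $0$ if all of them vanish). Elements $f_1,\dots,f_m$ form a $p$-basis of a ring $R$, $B\subseteq R\subseteq A$, over $B$ if the elements $f_1^{\alpha_1}\cdots f_m^{\alpha_m}$ with $0\le\alpha_1,\dots,\alpha_m<p$ form a basis of $R$ as a $B$-module. The ring of constants of a derivation is its kernel. The following conditions are equivalent: (1) $\operatorname{dgcd}(f_1,\dots,f_m)\sim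 1$; (2) $f_1,\dots,f_m$ form a $p$-basis over $B$ of the ring of constants of some $K$-derivation of $A$; (3) for every $i\in\{1,\dots,m\}$ and all $b,c\in R_i$ with $b\ne 0$ and $\gcd(b,c)\sim 1$, the polynomial $bf_i+c$ is square-free and $B$-free; and, if $m>1$, for all $i\neq j$ in $\{1,\dots,m\}$ and all $b_1,b_2,c_1,c_2\in R_{ij}$ with $b_1,b_2\neq 0$, $\gcd(b_1,c_1)\sim 1$ and $\gcd(b_2,c_2)\sim 1$, one has $\gcd(b_1f_i+c_1,\,b_2f_j+c_2)\sim 1$. (All greatest common divisors are taken in $A$.) -/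

import Mathlib

/-- The ring of constants of a `K`-derivation `d` of `A`: its kernel, as a `K`-subalgebra of `A`. -/
def ringOfConstants {K A : Type*} [CommRing K] [CommRing A] [Algebra K A]
    (d : Derivation K A A) : Subalgebra K A where
  carrier := {a | d a = 0}
  mul_mem' := by
    intro a b ha hb
    change d _ = 0
    simp [show d a = 0 from ha, show d b = 0 from hb]
  add_mem' := by
    intro a b ha hb
    change d _ = 0
    simp [show d a = 0 from ha, show d b = 0 from hb]
  algebraMap_mem' := by
    intro r
    change d _ = 0
    simp

/-- `f₁, …, fₘ` form a `p`-basis of `R` over `B`: the monomials `f₁ ^ α₁ ⋯ fₘ ^ αₘ` with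
`0 ≤ α₁, …, αₘ < p` form a basis of `R` as a `B`-module, that is, they are linearly independent
over `B` and their `B`-linear combinations are exactly the elements of `R`. -/
def IsPBasis {K A : Type*} [CommRing K] [CommRing A] [Algebra K A] (p : ℕ)
    (B R : Subalgebra K A) {m : ℕ} (f : Fin m → A) : Prop :=
  LinearIndependent B (fun α : Fin m → Fin p => ∏ i, f i ^ (α i : ℕ)) ∧
    (Submodule.span B (Set.range fun α : Fin m → Fin p => ∏ i, f i ^ (α i : ℕ)) : Set A) =
      (R : Set A)

/-- `a` is `B`-free: no noninvertible element of `B` divides `a`. -/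
def IsFreeOf {K A : Type*} [CommRing K] [CommRing A] [Algebra K A]
    (B : Subalgebra K A) (a : A) : Prop :=
  ∀ h ∈ B, h ∣ a → IsUnit h

/-- The subalgebra `K[x₁ ^ p, …, xₙ ^ p]` of `K[x₁, …, xₙ]`. -/
noncomputable def powSubalgebra (K : Type*) [CommRing K] (n p : ℕ) :
    Subalgebra K (MvPolynomial (Fin n) K) :=
  Algebra.adjoin K (Set.range fun i : Fin n => (MvPolynomial.X i : MvPolynomial (Fin n) K) ^ p)

/-- The ring `B[f_l : l ∉ s]`, where `B = K[x₁ ^ p, …, xₙ ^ p]`: the subring generated over `B` by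
those members of the family `f` whose index does not lie in `s`. -/
noncomputable def adjoinOmitting {K : Type*} [CommRing K] {m n : ℕ} (p : ℕ)
    (f : Fin m → MvPolynomial (Fin n) K) (s : Set (Fin m)) :
    Subalgebra (powSubalgebra K n p) (MvPolynomial (Fin n) K) :=
  Algebra.adjoin (powSubalgebra K n p) (f '' sᶜ)

/-- The jacobian determinant of `f₁, …, fₘ` with respect to `x_{j₁}, …, x_{jₘ}`. -/
noncomputable def jacobianMinor {K : Type*} [CommRing K] {m n : ℕ}
    (f : Fin m → MvPolynomial (Fin n) K) (j : Fin m → Fin n) : MvPolynomial (Fin n) K :=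
  (Matrix.of fun a b : Fin m => MvPolynomial.pderiv (j b) (f a)).det

open Classical in
/-- The differential gcd of `f₁, …, fₘ`: the greatest common divisor (determined up to a unit) of
all jacobian determinants with respect to `m` of the variables; it is `0` if all of them vanish. -/
noncomputable def dgcd {K : Type*} [CommRing K] [IsDomain K] [UniqueFactorizationMonoid K]
    {m n : ℕ} (f : Fin m → MvPolynomial (Fin n) K) : MvPolynomial (Fin n) K :=
  letI : StrongNormalizationMonoid (MvPolynomial (Fin n) K) :=
    UniqueFactorizationMonoid.strongNormalizationMonoid
  letI : NormalizedGCDMonoid (MvPolynomial (Fin n) K) :=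
    UniqueFactorizationMonoid.toNormalizedGCDMonoid _
  (Finset.univ : Finset (Fin m → Fin n)).gcd (jacobianMinor f)

/-- The defining property of the greatest common divisor. -/
theorem dvd_dgcd_iff {K : Type*} [CommRing K] [IsDomain K] [UniqueFactorizationMonoid K]
    {m n : ℕ} (f : Fin m → MvPolynomial (Fin n) K) (g : MvPolynomial (Fin n) K) :
    g ∣ dgcd f ↔ ∀ j : Fin m → Fin n, g ∣ jacobianMinor f j := by
  unfold dgcd
  simp [Finset.dvd_gcd_iff]

/-! ### Derivations of inseparable field extensions of exponent one. -/

section FieldDerivation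

variable {L : Type*} [Field L] {p : ℕ}

open Polynomial in
theorem X_pow_sub_C_eq_minpoly (hp : p.Prime) [CharP L p] (N : Subfield L) {x : L}
    (hxp : x ^ p ∈ N) (hx : x ∉ N) : X ^ p - C (⟨x ^ p, hxp⟩ : N) = minpoly N x := by
  have : Fact p.Prime := ⟨hp⟩
  have hirr : Irreducible (X ^ p - C (⟨x ^ p, hxp⟩ : N)) := by
    refine X_pow_sub_C_irreducible_of_prime hp fun b hb => hx ?_
    have h2 : (b : L) = x := frobenius_inj L p (congrArg Subtype.val hb)
    exact h2 ▸ b.2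
  refine minpoly.eq_of_irreducible_of_monic hirr ?_ (monic_X_pow_sub_C _ hp.ne_zero)
  rw [map_sub, map_pow, aeval_X, aeval_C, sub_eq_zero]
  rfl

open Polynomial IntermediateField in
/-- A purely inseparable simple extension of exponent one has the derivation `d / dx`. -/
theorem exists_derivation_of_adjoin_eq_top (hp : p.Prime) [CharP L p] (N : Subfield L) {x : L}
    (hxp : x ^ p ∈ N) (hx : x ∉ N) (htop : N⟮x⟯ = ⊤) : ∃ D : Derivation N L L, D x = 1 := by
  have halg : IsAlgebraic N x :=
    (IsIntegral.of_pow hp.pos (isIntegral_algebraMap (R := N) (x := ⟨x ^ p, hxp⟩))).isAlgebraic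
  have hsurj : Function.Surjective (aeval (R := N) x) := by
    rw [← AlgHom.range_eq_top, ← Algebra.adjoin_singleton_eq_range_aeval,
      ← IntermediateField.adjoin_simple_toSubalgebra_of_isAlgebraic halg, htop]
    rfl
  -- d/dX descends to the quotient by the minimal polynomial X ^ p - x ^ p, because the derivative
  -- of that polynomial is 0.
  have hker : ∀ q : N[X], aeval x q = 0 → aeval x (derivative' q) = 0 := by
    intro q hq
    obtain ⟨r, rfl⟩ := minpoly.dvd N x hq
    have hder : derivative (minpoly N x) = 0 := by
      rw [← X_pow_sub_C_eq_minpoly hp N hxp hx, derivative_sub, derivative_X_pow, derivative_C,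
        CharP.cast_eq_zero N p]
      simp
    rw [derivative'_apply, derivative_mul, hder, map_add, map_mul, map_mul, minpoly.aeval]
    simp
  refine ⟨Derivation.liftOfSurjective (R := N) hsurj (d := derivative') hker, ?_⟩
  simpa using Derivation.liftOfSurjective_apply (R := N) hsurj hker X

open IntermediateField in
/-- In an extension of exponent one, every element outside of the base field is moved by some
derivation over the base field. -/
theorem exists_derivation_ne_zero (hp : p.Prime) [CharP L p] (M : Subfield L)
    (hM : ∀ y : L, y ^ p ∈ M) {x : L} (hx : x ∉ M) :
    ∃ D : Derivation ℤ L L, (∀ y ∈ M, D y = 0) ∧ D x ≠ 0 := by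
  -- Enlarge the base field to one maximal among those missing x; x then turns out to generate L
  -- over it.
  obtain ⟨N, hMN, hN⟩ := zorn_le_nonempty₀ {N : Subfield L | x ∉ N} (by
    intro c hc hchain y hy
    refine ⟨sSup c, ?_, fun z hz => le_sSup hz⟩
    intro hmem
    obtain ⟨s, hs, hxs⟩ := (Subfield.mem_sSup_of_directedOn ⟨y, hy⟩ hchain.directedOn).1 hmem
    exact hc hs hxs) M hx
  have hNp : ∀ y : L, y ^ p ∈ N := fun y => hMN (hM y)
  have hint : ∀ y : L, IsIntegral N y := fun y =>
    IsIntegral.of_pow hp.pos (isIntegral_algebraMap (R := N) (x := ⟨y ^ p, hNp y⟩))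
  have hfin : ∀ y ∉ N, Module.finrank N N⟮y⟯ = p := by
    intro y hy
    rw [adjoin.finrank (hint y), ← X_pow_sub_C_eq_minpoly hp N (hNp y) hy,
      Polynomial.natDegree_X_pow_sub_C]
  have htop : N⟮x⟯ = ⊤ := by
    rw [eq_top_iff]
    intro y _
    by_cases hy : y ∈ N
    · exact N⟮x⟯.algebraMap_mem (⟨y, hy⟩ : N)
    -- By maximality x lies in N(y); both N(x) and N(y) have degree p over N, so they coincide.
    have hxy : x ∈ N⟮y⟯ := by
      by_contra hcon
      have hle : N ≤ N⟮y⟯.toSubfield := fun z hz => N⟮y⟯.algebraMap_mem (⟨z, hz⟩ : N)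
      exact hy (hN.2 (y := N⟮y⟯.toSubfield) hcon hle (mem_adjoin_simple_self N y))
    have hle : N⟮x⟯ ≤ N⟮y⟯ := adjoin_simple_le_iff.2 hxy
    have : FiniteDimensional N N⟮y⟯ := adjoin.finiteDimensional (hint y)
    rw [eq_of_le_of_finrank_eq hle ((hfin x hN.1).trans (hfin y hy).symm)]
    exact mem_adjoin_simple_self N y
  obtain ⟨D, hD⟩ := exists_derivation_of_adjoin_eq_top hp N (hNp x) hN.1 htop
  refine ⟨D.restrictScalars ℤ, fun y hy => D.map_algebraMap (⟨y, hMN hy⟩ : N), ?_⟩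
  rw [Derivation.restrictScalars_apply, hD]
  exact one_ne_zero

end FieldDerivation

/-! ### Fields of fractions with denominators in B, and dual derivations. -/

section FractionSubfield

variable {K A L : Type*} [CommRing K] [CommRing A] [Algebra K A] [Field L] {p : ℕ}
  {B : Subalgebra K A}

/-- The subfield of `L` consisting of the fractions whose numerators are images of elements of the
subalgebra `R` of `A`, and whose denominators are images of elements of `B`, if `B` contains all
`p`-th powers. -/
def fractionSubfield (hp : p ≠ 0) (hB : ∀ a : A, a ^ p ∈ B) (φ : A →+* L) (R : Subalgebra B A) :
    Subfield L where
  carrier := {x | ∃ c ∈ R, ∃ b ∈ B, φ b ≠ 0 ∧ φ b * x = φ c}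
  mul_mem' := by
    rintro x y ⟨c, hc, b, hb, hb0, h⟩ ⟨c', hc', b', hb', hb0', h'⟩
    refine ⟨c * c', R.mul_mem hc hc', b * b', B.mul_mem hb hb', ?_, ?_⟩
    · rw [map_mul]
      exact mul_ne_zero hb0 hb0'
    · rw [map_mul, map_mul, ← h, ← h']
      ring
  one_mem' := ⟨1, R.one_mem, 1, B.one_mem, by simp, by simp⟩
  add_mem' := by
    rintro x y ⟨c, hc, b, hb, hb0, h⟩ ⟨c', hc', b', hb', hb0', h'⟩
    refine ⟨b' * c + b * c', R.add_mem (R.mul_mem (R.algebraMap_mem ⟨b', hb'⟩) hc)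
      (R.mul_mem (R.algebraMap_mem ⟨b, hb⟩) hc'), b * b', B.mul_mem hb hb', ?_, ?_⟩
    · rw [map_mul]
      exact mul_ne_zero hb0 hb0'
    · rw [map_add, map_mul, map_mul, map_mul, ← h, ← h']
      ring
  zero_mem' := ⟨0, R.zero_mem, 1, B.one_mem, by simp, by simp⟩
  neg_mem' := by
    rintro x ⟨c, hc, b, hb, hb0, h⟩
    exact ⟨-c, R.neg_mem hc, b, hb, hb0, by rw [map_neg, ← h]; ring⟩
  inv_mem' := by
    rintro x ⟨c, hc, b, hb, hb0, h⟩
    rcases eq_or_ne x 0 with rfl | hx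
    · exact ⟨0, R.zero_mem, 1, B.one_mem, by simp, by simp⟩
    have hc0 : φ c ≠ 0 := h ▸ mul_ne_zero hb0 hx
    -- The inverse of c / b is c ^ (p - 1) * b / c ^ p, whose denominator lies in B.
    refine ⟨c ^ (p - 1) * b, R.mul_mem (R.pow_mem hc _) (R.algebraMap_mem ⟨b, hb⟩), c ^ p, hB c,
      by rw [map_pow]; exact pow_ne_zero _ hc0, ?_⟩
    obtain ⟨q, rfl⟩ := Nat.exists_eq_succ_of_ne_zero hp
    have h1 : φ b = φ c * x⁻¹ := by rw [← h, mul_assoc, mul_inv_cancel₀ hx, mul_one]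
    rw [map_mul, h1]
    simp only [map_pow, Nat.succ_eq_add_one, Nat.add_sub_cancel]
    ring

variable (hp : p ≠ 0) (hB : ∀ a : A, a ^ p ∈ B) (φ : A →+* L)

theorem map_mem_fractionSubfield {R : Subalgebra B A} {a : A} (ha : a ∈ R) :
    φ a ∈ fractionSubfield hp hB φ R :=
  ⟨a, ha, 1, B.one_mem, by simp, by simp⟩

theorem pow_mem_fractionSubfield (hL : ∀ x : L, ∃ a b, φ b ≠ 0 ∧ φ b * x = φ a)
    (R : Subalgebra B A) (x : L) : x ^ p ∈ fractionSubfield hp hB φ R := by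
  obtain ⟨a, b, hb, h⟩ := hL x
  refine ⟨a ^ p, R.algebraMap_mem ⟨_, hB a⟩, b ^ p, hB b, ?_, ?_⟩
  · rw [map_pow]
    exact pow_ne_zero _ hb
  · rw [map_pow, map_pow, ← h, mul_pow]

theorem fractionSubfield_adjoin_le {s : Set A} {R : Subalgebra B A}
    (h : ∀ a ∈ s, φ a ∈ fractionSubfield hp hB φ R) :
    fractionSubfield hp hB φ (Algebra.adjoin B s) ≤ fractionSubfield hp hB φ R := by
  have key : ∀ c ∈ Algebra.adjoin B s, φ c ∈ fractionSubfield hp hB φ R := by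
    intro c hc
    induction hc using Algebra.adjoin_induction with
    | mem x hx => exact h x hx
    | algebraMap b => exact map_mem_fractionSubfield hp hB φ (R.algebraMap_mem b)
    | add x y _ _ hx hy =>
      rw [map_add]
      exact add_mem hx hy
    | mul x y _ _ hx hy =>
      rw [map_mul]
      exact mul_mem hx hy
  rintro x ⟨c, hc, b, hb, hb0, hx⟩
  have : x = φ c / φ b := by rw [← hx, mul_div_cancel_left₀ _ hb0]
  rw [this]
  exact div_mem (key c hc) (map_mem_fractionSubfield hp hB φ (R.algebraMap_mem ⟨b, hb⟩))

/-- A minimal subfamily of a finite family `y` that generates the same field over a given set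
`s₀`, with derivations that separate its members. -/
theorem exists_finset_derivation (hp : p.Prime) [CharP L p] (hB : ∀ a : A, a ^ p ∈ B)
    (φ : A →+* L) (hL : ∀ x : L, ∃ a b, φ b ≠ 0 ∧ φ b * x = φ a)
    {ι : Type*} [Fintype ι] (s₀ : Set A) (y : ι → A) :
    ∃ T : Finset ι,
      (∀ i, φ (y i) ∈ fractionSubfield hp.ne_zero hB φ (Algebra.adjoin B (s₀ ∪ y '' T))) ∧
      ∀ t ∈ T, ∃ D : Derivation ℤ L L, (∀ b ∈ B, D (φ b) = 0) ∧ (∀ a ∈ s₀, D (φ a) = 0) ∧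
        (∀ l ∈ T, l ≠ t → D (φ (y l)) = 0) ∧ D (φ (y t)) ≠ 0 := by
  classical
  let P : Set (Finset ι) := {T | ∀ i, φ (y i) ∈
    fractionSubfield hp.ne_zero hB φ (Algebra.adjoin B (s₀ ∪ y '' T))}
  have hne : P.Nonempty := ⟨Finset.univ, fun i => map_mem_fractionSubfield _ _ _
    (Algebra.subset_adjoin (Or.inr ⟨i, by simp, rfl⟩))⟩
  obtain ⟨T, hT⟩ := P.toFinite.exists_minimal hne
  refine ⟨T, hT.1, fun t ht => ?_⟩
  have hnot : φ (y t) ∉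
      fractionSubfield hp.ne_zero hB φ (Algebra.adjoin B (s₀ ∪ y '' (T.erase t : Finset ι))) := by
    intro hmem
    refine Finset.notMem_erase t T (hT.2 (y := T.erase t) (fun i => ?_) (Finset.erase_subset _ _) ht)
    refine fractionSubfield_adjoin_le hp.ne_zero hB φ ?_ (hT.1 i)
    rintro a (ha | ⟨l, hl, rfl⟩)
    · exact map_mem_fractionSubfield _ _ _ (Algebra.subset_adjoin (Or.inl ha))
    · rcases eq_or_ne l t with rfl | hlt
      · exact hmem
      · exact map_mem_fractionSubfield _ _ _
          (Algebra.subset_adjoin (Or.inr ⟨l, Finset.mem_erase.2 ⟨hlt, hl⟩, rfl⟩))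
  obtain ⟨D, hD, hDt⟩ := exists_derivation_ne_zero hp _
    (pow_mem_fractionSubfield hp.ne_zero hB φ hL _) hnot
  refine ⟨D, fun b hb => hD _ (map_mem_fractionSubfield _ _ _ (Subalgebra.algebraMap_mem _ (⟨b, hb⟩ : B))),
    fun a ha => hD _ (map_mem_fractionSubfield _ _ _ (Algebra.subset_adjoin (Or.inl ha))),
    fun l hl hlt => hD _ (map_mem_fractionSubfield _ _ _
      (Algebra.subset_adjoin (Or.inr ⟨l, Finset.mem_erase.2 ⟨hlt, hl⟩, rfl⟩))), hDt⟩

end FractionSubfield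

open MvPolynomial

/-! ### Partial derivatives, the chain rule over B, and Jacobian minors. -/

section Basics

variable {K : Type*} [CommRing K] {n p : ℕ}

theorem pderiv_eq_zero_of_mem_powSubalgebra [CharP K p] {h : MvPolynomial (Fin n) K}
    (hh : h ∈ powSubalgebra K n p) (j : Fin n) : pderiv j h = 0 := by
  induction hh using Algebra.adjoin_induction with
  | mem x hx =>
    obtain ⟨i, rfl⟩ := hx
    simp
  | algebraMap r => simp
  | add x y _ _ hx hy => simp [hx, hy]
  | mul x y _ _ hx hy => simp [hx, hy]

/-- In each monomial that occurs, exponent times coefficient vanishes in the domain K, so p divides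
every exponent. -/
theorem mem_powSubalgebra_of_pderiv_eq_zero [IsDomain K] [CharP K p]
    {h : MvPolynomial (Fin n) K} (hh : ∀ j, pderiv j h = 0) : h ∈ powSubalgebra K n p := by
  rw [h.as_sum]
  refine Subalgebra.sum_mem _ fun s hs => ?_
  rw [monomial_eq, Finsupp.prod_fintype _ _ (by simp)]
  refine Subalgebra.mul_mem _ (Subalgebra.algebraMap_mem _ (coeff s h))
    (Subalgebra.prod_mem _ fun j _ => ?_)
  have hdvd : p ∣ s j := by
    rcases Nat.eq_zero_or_pos (s j) with h0 | h0
    · simp [h0]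
    have h1 := congrArg (coeff (s - Finsupp.single j 1)) (hh j)
    have h2 : s - Finsupp.single j 1 + Finsupp.single j 1 = s :=
      tsub_add_cancel_of_le (by simpa [Nat.one_le_iff_ne_zero] using h0.ne')
    have h3 : (s - Finsupp.single j 1 : Fin n →₀ ℕ) j + 1 = s j := by
      simp; omega
    rw [coeff_pderiv, h2, coeff_zero, ← Nat.cast_succ, Nat.succ_eq_add_one, h3] at h1
    rcases mul_eq_zero.1 h1 with h4 | h4
    · exact absurd h4 (mem_support_iff.1 hs)
    · exact (CharP.cast_eq_zero_iff K p _).1 h4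
  obtain ⟨k, hk⟩ := hdvd
  rw [hk, pow_mul]
  exact Subalgebra.pow_mem _ (Algebra.subset_adjoin (Set.mem_range_self j)) k

theorem pow_mem_powSubalgebra [IsDomain K] [CharP K p] (a : MvPolynomial (Fin n) K) :
    a ^ p ∈ powSubalgebra K n p :=
  mem_powSubalgebra_of_pderiv_eq_zero fun j => by simp

variable {m : ℕ} {f : Fin m → MvPolynomial (Fin n) K}

theorem exists_aeval_eq_of_mem_adjoinOmitting {s : Set (Fin m)} {c : MvPolynomial (Fin n) K}
    (hc : c ∈ adjoinOmitting p f s) :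
    ∃ C : MvPolynomial (Fin m) (powSubalgebra K n p),
      aeval f C = c ∧ ∀ l ∈ s, pderiv l C = 0 := by
  induction hc using Algebra.adjoin_induction with
  | mem x hx =>
    obtain ⟨i, hi, rfl⟩ := hx
    refine ⟨X i, by simp, fun l hl => pderiv_X_of_ne ?_⟩
    rintro rfl
    exact hi hl
  | algebraMap r => exact ⟨C r, by simp, by simp⟩
  | add x y _ _ hx hy =>
    obtain ⟨P, rfl, hP⟩ := hx
    obtain ⟨Q, rfl, hQ⟩ := hy
    exact ⟨P + Q, by simp, fun l hl => by simp [hP l hl, hQ l hl]⟩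
  | mul x y _ _ hx hy =>
    obtain ⟨P, rfl, hP⟩ := hx
    obtain ⟨Q, rfl, hQ⟩ := hy
    exact ⟨P * Q, by simp, fun l hl => by simp [hP l hl, hQ l hl]⟩

/-- The chain rule: coefficients from B contribute nothing, being killed by all partial derivatives.
-/
theorem pderiv_aeval_powSubalgebra [CharP K p] (Φ : MvPolynomial (Fin m) (powSubalgebra K n p))
    (j : Fin n) :
    pderiv j (aeval f Φ) = ∑ l, aeval f (pderiv l Φ) * pderiv j (f l) := by
  induction Φ using MvPolynomial.induction_on with
  | C a =>
    simp only [aeval_C, pderiv_C, map_zero, zero_mul, Finset.sum_const_zero]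
    exact pderiv_eq_zero_of_mem_powSubalgebra a.2 j
  | add P Q hP hQ => simp [hP, hQ, add_mul, Finset.sum_add_distrib]
  | mul_X P i hP =>
    classical
    simp only [map_mul, aeval_X, pderiv_mul, hP, pderiv_X, map_add, add_mul,
      Finset.sum_add_distrib, Finset.sum_mul]
    congr 1
    · exact Finset.sum_congr rfl fun l _ => by ring
    · rw [Finset.sum_eq_single i]
      · simp
      · intro l _ hl
        simp [Ne.symm hl]
      · simp

/-- The determinant is linear in row i, and the multiples of the other rows drop out. -/
theorem jacobianMinor_update {F : MvPolynomial (Fin n) K} {γ : Fin m → MvPolynomial (Fin n) K}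
    (hF : ∀ k, pderiv k F = ∑ l, γ l * pderiv k (f l)) (i : Fin m) (j : Fin m → Fin n) :
    jacobianMinor (Function.update f i F) j = γ i * jacobianMinor f j := by
  unfold jacobianMinor
  have h := Matrix.det_updateRow_sum (Matrix.of fun a b : Fin m => pderiv (j b) (f a)) i γ
  rw [smul_eq_mul] at h
  rw [← h]
  congr 1
  ext a b
  rcases eq_or_ne a i with rfl | ha
  · simp [hF]
  · simp [ha]

theorem exists_gradient_of_mem_adjoinOmitting [CharP K p] {s : Set (Fin m)}
    {c : MvPolynomial (Fin n) K} (hc : c ∈ adjoinOmitting p f s) :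
    ∃ γ : Fin m → MvPolynomial (Fin n) K, (∀ l ∈ s, γ l = 0) ∧
      ∀ k, pderiv k c = ∑ l, γ l * pderiv k (f l) := by
  obtain ⟨C, rfl, hC⟩ := exists_aeval_eq_of_mem_adjoinOmitting hc
  exact ⟨fun l => aeval f (pderiv l C), fun l hl => by simp [hC l hl],
    pderiv_aeval_powSubalgebra C⟩

/-- The gradient of `b * f i + c` in terms of those of the `f l`. -/
theorem exists_gradient_mul_add [CharP K p] {s : Set (Fin m)} {i : Fin m} (hi : i ∈ s)
    {b c : MvPolynomial (Fin n) K} (hb : b ∈ adjoinOmitting p f s)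
    (hc : c ∈ adjoinOmitting p f s) :
    ∃ γ : Fin m → MvPolynomial (Fin n) K, γ i = b ∧ (∀ l ∈ s, l ≠ i → γ l = 0) ∧
      ∀ k, pderiv k (b * f i + c) = ∑ l, γ l * pderiv k (f l) := by
  obtain ⟨β, hβ, hβ'⟩ := exists_gradient_of_mem_adjoinOmitting hb
  obtain ⟨γ, hγ, hγ'⟩ := exists_gradient_of_mem_adjoinOmitting hc
  refine ⟨fun l => β l * f i + Pi.single (M := fun _ => MvPolynomial (Fin n) K) i b l + γ l,
    by simp [hβ i hi, hγ i hi],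
    fun l hl hli => by simp [hβ l hl, hγ l hl, hli], fun k => ?_⟩
  simp only [map_add, pderiv_mul, hβ', hγ', add_mul, Finset.sum_add_distrib, Finset.sum_mul]
  congr 2
  · exact Finset.sum_congr rfl fun l _ => by ring
  · rw [Finset.sum_eq_single i]
    · simp
    · intro l _ hl
      simp [hl]
    · simp

end Basics

/-! ### Consequences of a prime dividing all minors. -/

section Dependence

theorem totalDegree_pderiv_lt {σ R : Type*} [CommSemiring R] {F : MvPolynomial σ R} {i : σ}
    (h : pderiv i F ≠ 0) : (pderiv i F).totalDegree < F.totalDegree := by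
  have key : ∀ s ∈ (pderiv i F).support, (s.sum fun _ e => e) < F.totalDegree := by
    intro s hs
    have hs' : s + Finsupp.single i 1 ∈ F.support := by
      rw [mem_support_iff] at hs ⊢
      rw [coeff_pderiv] at hs
      exact left_ne_zero_of_mul hs
    have := le_totalDegree hs'
    rw [Finsupp.sum_add_index' (by simp) (by simp), Finsupp.sum_single_index (by simp)] at this
    omega
  obtain ⟨s, hs⟩ := support_nonempty.2 h
  exact (Finset.sup_lt_iff (lt_of_le_of_lt (Nat.zero_le _) (key s hs))).2 key

theorem pderiv_eq_zero_of_dvd {σ R : Type*} [CommRing R] [IsDomain R] {g : MvPolynomial σ R}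
    {i : σ} (h : g ∣ pderiv i g) : pderiv i g = 0 := by
  by_contra h0
  obtain ⟨q, hq⟩ := h
  have h1 := totalDegree_pderiv_lt h0
  have hg : g ≠ 0 := by
    rintro rfl
    simp at h0
  have hq0 : q ≠ 0 := by
    rintro rfl
    exact h0 (by simpa using hq)
  rw [hq, totalDegree_mul_of_isDomain hg hq0] at h1
  omega

/-- The matrix is diagonal except possibly in row i. A null vector vanishes away from i by the other
rows, and then at i by row i. -/
theorem Matrix.det_ne_zero_of_offDiag_eq_zero {ι R : Type*} [Fintype ι] [DecidableEq ι] [CommRing R]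
    [IsDomain R] {M : Matrix ι ι R} (i : ι) (hoff : ∀ k l, k ≠ i → l ≠ k → M k l = 0)
    (hdiag : ∀ k, M k k ≠ 0) : M.det ≠ 0 := by
  intro hdet
  obtain ⟨v, hv, hMv⟩ := Matrix.exists_mulVec_eq_zero_iff.2 hdet
  have hk : ∀ k, k ≠ i → v k = 0 := by
    intro k hki
    have h1 := congrFun hMv k
    rw [Matrix.mulVec, dotProduct, Finset.sum_eq_single k
      (fun l _ hl => by rw [hoff k l hki hl, zero_mul]) (by simp)] at h1
    exact (mul_eq_zero.1 h1).resolve_left (hdiag k)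
  refine hv (funext fun k => ?_)
  by_cases hki : k = i
  · subst hki
    have h1 := congrFun hMv k
    rw [Matrix.mulVec, dotProduct, Finset.sum_eq_single k
      (fun l _ hl => by rw [hk l hl, mul_zero]) (by simp)] at h1
    exact (mul_eq_zero.1 h1).resolve_left (hdiag k)
  · exact hk k hki

variable {K : Type*} [CommRing K] {n p : ℕ}

theorem derivation_map_eq_sum {L : Type*} [CommRing L] (φ : MvPolynomial (Fin n) K →+* L)
    (D : Derivation ℤ L L) (hD : ∀ r, D (φ (C r)) = 0) (h : MvPolynomial (Fin n) K) :
    D (φ h) = ∑ k, D (φ (X k)) * φ (pderiv k h) := by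
  induction h using MvPolynomial.induction_on with
  | C a => simp [hD]
  | add P Q hP hQ => simp [hP, hQ, mul_add, Finset.sum_add_distrib]
  | mul_X P i hP =>
    classical
    simp only [map_mul, Derivation.leibniz, smul_eq_mul, hP, map_add, mul_add,
      Finset.sum_add_distrib, Finset.mul_sum, pderiv_X]
    congr 1
    · rw [Finset.sum_eq_single i]
      · simp
        ring
      · intro l _ hl
        simp [Ne.symm hl]
      · simp
    · exact Finset.sum_congr rfl fun l _ => by ring

variable {m : ℕ} {f : Fin m → MvPolynomial (Fin n) K}

/-- A weak Cauchy–Binet: expanding the rows multilinearly leaves a combination of minors. -/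
theorem det_eq_zero_of_jacobianMinor {L : Type*} [CommRing L] (φ : MvPolynomial (Fin n) K →+* L)
    (h : ∀ j, φ (jacobianMinor f j) = 0) (v : Fin m → Fin n → L) :
    (Matrix.of fun a b => ∑ k, v a k * φ (pderiv k (f b))).det = 0 := by
  have h1 : (Matrix.of fun a b => ∑ k, v a k * φ (pderiv k (f b))) =
      fun a => ∑ k, v a k • fun b => φ (pderiv k (f b)) := by
    ext a b
    simp
  have h2 := (Matrix.detRowAlternating (n := Fin m) (R := L)).toMultilinearMap.map_sum
    (fun a k => v a k • fun b => φ (pderiv k (f b)))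
  rw [h1]
  refine h2.trans (Finset.sum_eq_zero fun r _ => ?_)
  rw [MultilinearMap.map_smul_univ]
  have h3 : (Matrix.detRowAlternating (n := Fin m) (R := L)).toMultilinearMap
      (fun a b => φ (pderiv (r a) (f b))) = φ (jacobianMinor f r) := by
    rw [jacobianMinor, RingHom.map_det, ← Matrix.det_transpose]
    rfl
  rw [h3, h r, smul_zero]

theorem isUnit_or_exists_prime_dvd [IsDomain K] [UniqueFactorizationMonoid K] (hn : 1 ≤ n)
    (a : MvPolynomial (Fin n) K) : IsUnit a ∨ ∃ g, Prime g ∧ g ∣ a := by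
  by_cases ha : IsUnit a
  · exact Or.inl ha
  rcases eq_or_ne a 0 with rfl | h0
  · exact Or.inr ⟨X ⟨0, hn⟩, X_prime, dvd_zero _⟩
  · obtain ⟨g, hg, hga⟩ := WfDvdMonoid.exists_irreducible_factor ha h0
    exact Or.inr ⟨g, hg.prime, hga⟩

/-- If a prime `g` divides all the jacobian minors of the `f i`, then modulo `g` either two of the
`f i` are rational functions of the others, or one of them is, in an exceptional way. -/
theorem exists_dvd_mul_add [IsDomain K] [CharP K p] (hp : p.Prime) (hm : 1 ≤ m)
    {g : MvPolynomial (Fin n) K} (hg : Prime g) (hmin : ∀ j, g ∣ jacobianMinor f j) :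
    (∃ i j, i ≠ j ∧ ∃ b₁ ∈ powSubalgebra K n p, ∃ b₂ ∈ powSubalgebra K n p,
      ∃ c₁ ∈ adjoinOmitting p f {i, j}, ∃ c₂ ∈ adjoinOmitting p f {i, j},
        ¬ g ∣ b₁ ∧ ¬ g ∣ b₂ ∧ g ∣ b₁ * f i + c₁ ∧ g ∣ b₂ * f j + c₂) ∨
    ∃ i, ∃ b ∈ powSubalgebra K n p, ∃ c ∈ adjoinOmitting p f {i},
      ¬ g ∣ b ∧ g ∣ b * f i + c ∧ (g ∈ powSubalgebra K n p ∨ g ^ 2 ∣ b * f i + c) := by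
  classical
  have hprime : (Ideal.span {g}).IsPrime := (Ideal.span_singleton_prime hg.ne_zero).2 hg
  let L := FractionRing (MvPolynomial (Fin n) K ⧸ Ideal.span {g})
  let φ : MvPolynomial (Fin n) K →+* L :=
    (algebraMap (MvPolynomial (Fin n) K ⧸ Ideal.span {g}) L).comp (Ideal.Quotient.mk _)
  have hφ : ∀ a, φ a = 0 ↔ g ∣ a := by
    intro a
    rw [← Ideal.mem_span_singleton, ← Ideal.Quotient.eq_zero_iff_mem]
    exact map_eq_zero_iff (algebraMap (MvPolynomial (Fin n) K ⧸ Ideal.span {g}) L)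
      (IsFractionRing.injective _ L)
  have hL : ∀ x : L, ∃ a b, φ b ≠ 0 ∧ φ b * x = φ a := by
    intro x
    obtain ⟨a, b, hb, rfl⟩ := IsFractionRing.div_surjective
      (A := MvPolynomial (Fin n) K ⧸ Ideal.span {g}) x
    obtain ⟨a, rfl⟩ := Ideal.Quotient.mk_surjective a
    obtain ⟨b, rfl⟩ := Ideal.Quotient.mk_surjective b
    have hb0 : φ b ≠ 0 := fun h => nonZeroDivisors.ne_zero hb
      (IsFractionRing.injective _ L (h.trans (map_zero _).symm))
    exact ⟨a, b, hb0, mul_div_cancel₀ _ hb0⟩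
  have : CharP L p := (CharP.charP_iff_prime_eq_zero hp).2 (by
    rw [← map_natCast φ, CharP.cast_eq_zero, map_zero])
  have hB : ∀ a : MvPolynomial (Fin n) K, a ^ p ∈ powSubalgebra K n p := pow_mem_powSubalgebra
  obtain ⟨T, hT, hD⟩ := exists_finset_derivation hp hB φ hL ∅ f
  choose! D hDB _ hDT hDt using hD
  have hDsum : ∀ t ∈ T, ∀ h, D t (φ h) = ∑ k, D t (φ (X k)) * φ (pderiv k h) := fun t ht =>
    derivation_map_eq_sum φ (D t) fun r => hDB t ht _ (Subalgebra.algebraMap_mem _ r)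
  have hrel : ∀ i (s : Set (Fin m)), (∀ l ∈ T, l ∉ s) → ∃ b ∈ powSubalgebra K n p,
      ∃ c ∈ adjoinOmitting p f s, ¬ g ∣ b ∧ g ∣ b * f i + c := by
    intro i s hs
    obtain ⟨c, hc, b, hb, hb0, h⟩ := hT i
    refine ⟨b, hb, -c, Subalgebra.neg_mem _ (Algebra.adjoin_mono ?_ hc),
      fun h => hb0 ((hφ b).2 h), ?_⟩
    · rw [Set.empty_union]
      exact Set.image_mono hs
    · rw [← hφ, map_add, map_mul, h, map_neg, add_neg_cancel]
  -- If nothing is omitted, the matrix of the D_t(f_l) is diagonal with nonzero diagonal, yet it is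
  -- a product with the Jacobian matrix, whose minors vanish in L.
  by_cases huniv : ∀ i, i ∈ T
  · exfalso
    have hdet := det_eq_zero_of_jacobianMinor φ (fun j => (hφ _).2 (hmin j))
      fun t k => D t (φ (X k))
    simp only [← fun t => hDsum t (huniv t)] at hdet
    exact Matrix.det_ne_zero_of_offDiag_eq_zero ⟨0, hm⟩
      (fun k l _ hlk => hDT k (huniv k) l (huniv l) hlk) (fun k => hDt k (huniv k)) hdet
  push Not at huniv
  obtain ⟨i, hi⟩ := huniv
  by_cases hex : ∃ j, j ≠ i ∧ j ∉ T
  · obtain ⟨j, hji, hj⟩ := hex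
    have hs : ∀ l ∈ T, l ∉ ({i, j} : Set (Fin m)) := by
      rintro l hl (rfl | rfl)
      · exact hi hl
      · exact hj hl
    obtain ⟨b₁, hb₁, c₁, hc₁, h₁, h₁'⟩ := hrel i {i, j} hs
    obtain ⟨b₂, hb₂, c₂, hc₂, h₂, h₂'⟩ := hrel j {i, j} hs
    exact Or.inl ⟨i, j, hji.symm, b₁, hb₁, b₂, hb₂, c₁, hc₁, c₂, hc₂, h₁, h₂, h₁', h₂'⟩
  push Not at hex
  obtain ⟨b, hb, c, hc, hgb, hgF⟩ := hrel i {i} (by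
    rintro l hl rfl
    exact hi hl)
  refine Or.inr ⟨i, b, hb, c, hc, hgb, hgF, ?_⟩
  -- For degree reasons, `g` divides its own partial derivatives only if they all vanish, that is, g
  -- ∈ B.
  by_cases hder : ∀ k, g ∣ pderiv k g
  · exact Or.inl (mem_powSubalgebra_of_pderiv_eq_zero fun k => pderiv_eq_zero_of_dvd (hder k))
  right
  push Not at hder
  obtain ⟨k₀, hk₀⟩ := hder
  by_contra hg2
  obtain ⟨γ, hγi, -, hγ⟩ := exists_gradient_mul_add (Set.mem_singleton i)
    (Subalgebra.algebraMap_mem _ (⟨b, hb⟩ : powSubalgebra K n p)) hc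
  replace hγi : γ i = b := hγi
  replace hγ : ∀ k, pderiv k (b * f i + c) = ∑ l, γ l * pderiv k (f l) := hγ
  obtain ⟨h, hF⟩ := hgF
  rw [hF] at hγ hg2
  have hh : φ h ≠ 0 := fun h0 => hg2 (by
    rw [pow_two]
    exact mul_dvd_mul_left g ((hφ h).1 h0))
  -- With f_i replaced by g h the minors still vanish modulo `g`. Row i uses ∂/∂x_{k₀} on A in place
  -- of a derivation of L: modulo `g` it sends g h to h ∂g/∂x_{k₀} ≠ 0, while the other rows kill g
  -- h.
  have hdet := det_eq_zero_of_jacobianMinor (f := Function.update f i (g * h)) φ (fun j => by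
    rw [jacobianMinor_update hγ, map_mul, (hφ _).2 (hmin j), mul_zero])
    fun t k => if t ∈ T then D t (φ (X k)) else Pi.single (M := fun _ => L) k₀ 1 k
  have hφg : φ g = 0 := (hφ g).2 dvd_rfl
  refine Matrix.det_ne_zero_of_offDiag_eq_zero i (fun k l hki hlk => ?_) (fun k => ?_) hdet
  · have hk := hex k hki
    simp only [Matrix.of_apply, hk, if_true, ← hDsum k hk]
    rcases eq_or_ne l i with rfl | hli
    · rw [Function.update_self, map_mul, hφg, zero_mul, map_zero]
    · rw [Function.update_of_ne hli]
      exact hDT k hk l (hex l hli) hlk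
  · rcases eq_or_ne k i with rfl | hki
    · simp only [Matrix.of_apply, hi, if_false, Function.update_self]
      rw [Finset.sum_eq_single k₀ (fun l _ hl => by simp [hl]) (by simp), pderiv_mul]
      simp only [Pi.single_eq_same, one_mul, map_add, map_mul, hφg, zero_mul, add_zero]
      exact mul_ne_zero (fun h0 => hk₀ ((hφ _).1 h0)) hh
    · have hk := hex k hki
      simp only [Matrix.of_apply, hk, if_true, ← hDsum k hk, Function.update_of_ne hki]
      exact hDt k hk

end Dependence

/-! ### Condition (1) against square-freeness, B-freeness and coprimality. -/

section SquarefreeFree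

theorem Matrix.det_eq_zero_of_rows_eq_smul {ι R : Type*} [Fintype ι] [DecidableEq ι] [CommRing R]
    {M : Matrix ι ι R} {i j : ι} (hij : i ≠ j) {u v : R} {w : ι → R} (hi : M i = u • w)
    (hj : M j = v • w) : M.det = 0 := by
  have h1 : M = M.updateRow i (u • w) := by rw [← hi, Matrix.updateRow_eq_self]
  have h2 : M.updateRow i w = (M.updateRow i w).updateRow j (v • w) := by
    rw [← hj, Matrix.updateRow_comm _ hij, Matrix.updateRow_eq_self]
  rw [h1, Matrix.det_updateRow_smul, h2, Matrix.det_updateRow_smul,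
    Matrix.det_zero_of_row_eq hij (by
      rw [Matrix.updateRow_ne hij, Matrix.updateRow_self, Matrix.updateRow_self]),
    mul_zero, mul_zero]

/-- Take for t the product of the prime factors of b not dividing c. A prime of b then divides
exactly one of c and t g, since it is not associated to `g`. -/
theorem exists_isRelPrime_add_pow {R : Type*} [CommRing R] [IsDomain R]
    [UniqueFactorizationMonoid R] {p : ℕ} (hp : p ≠ 0) {b g : R} (c : R) (hg : Prime g)
    (hgb : ¬ g ∣ b) : ∃ t, IsRelPrime b (c + (t * g) ^ p) := by
  classical
  have hb : b ≠ 0 := by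
    rintro rfl
    exact hgb (dvd_zero g)
  let S := (UniqueFactorizationMonoid.factors b).filter fun q => ¬ q ∣ c
  refine ⟨S.prod, (UniqueFactorizationMonoid.isRelPrime_iff_no_prime_factors hb).2 ?_⟩
  intro d hdb hd hdp
  obtain ⟨q, hq, hdq⟩ := UniqueFactorizationMonoid.exists_mem_factors_of_dvd hb hdp.irreducible hdb
  by_cases hdc : d ∣ c
  · have h1 : d ∣ S.prod * g := hdp.dvd_of_dvd_pow ((dvd_add_right hdc).1 hd)
    rcases hdp.dvd_or_dvd h1 with h2 | h2
    · obtain ⟨r, hr, hdr⟩ := hdp.exists_mem_multiset_dvd h2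
      obtain ⟨hr1, hr2⟩ := Multiset.mem_filter.1 hr
      have hass : Associated d r :=
        hdp.associated_of_dvd (UniqueFactorizationMonoid.prime_of_factor r hr1) hdr
      exact hr2 (hass.symm.dvd.trans hdc)
    · exact hgb ((hdp.associated_of_dvd hg h2).symm.dvd.trans hdb)
  · have hqS : q ∈ S := Multiset.mem_filter.2 ⟨hq, fun h => hdc (hdq.dvd.trans h)⟩
    have h1 : d ∣ (S.prod * g) ^ p :=
      dvd_pow (dvd_mul_of_dvd_left (hdq.dvd.trans (Multiset.dvd_prod hqS)) g) hp
    exact hdc ((dvd_add_left h1).1 hd)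

variable {K : Type*} [CommRing K] {m n p : ℕ} {f : Fin m → MvPolynomial (Fin n) K}

theorem associated_dgcd_one_iff [IsDomain K] [UniqueFactorizationMonoid K] (hn : 1 ≤ n) :
    Associated (dgcd f) 1 ↔ ∀ g, Prime g → ¬ ∀ j, g ∣ jacobianMinor f j := by
  rw [associated_one_iff_isUnit]
  constructor
  · intro h g hg hmin
    exact hg.not_isUnit (isUnit_of_dvd_unit ((dvd_dgcd_iff f g).2 hmin) h)
  · intro h
    refine (isUnit_or_exists_prime_dvd hn (dgcd f)).resolve_right ?_
    rintro ⟨g, hg, hgd⟩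
    exact h g hg ((dvd_dgcd_iff f g).1 hgd)

/-- Cramer's rule modulo `g`: with F in place of f_i, row i of the minor vanishes, and the minor
equals γ i times the old one. -/
theorem dvd_coeff_of_dvd_gradient {g : MvPolynomial (Fin n) K} (hg : Prime g)
    (hmin : ¬ ∀ j, g ∣ jacobianMinor f j) {F : MvPolynomial (Fin n) K}
    {γ : Fin m → MvPolynomial (Fin n) K} (hF : ∀ k, pderiv k F = ∑ l, γ l * pderiv k (f l))
    (hgF : ∀ k, g ∣ pderiv k F) (i : Fin m) : g ∣ γ i := by
  push Not at hmin
  obtain ⟨j, hj⟩ := hmin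
  refine (hg.dvd_or_dvd ?_).resolve_right hj
  rw [← jacobianMinor_update hF i j, ← Ideal.mem_span_singleton, ← Ideal.Quotient.eq_zero_iff_mem,
    jacobianMinor, RingHom.map_det]
  refine Matrix.det_eq_zero_of_row_eq_zero i fun k => ?_
  simpa [Ideal.Quotient.eq_zero_iff_mem, Ideal.mem_span_singleton] using hgF (j k)

/-- Put F₁, F₂ in rows i, j. Modulo `g` both rows are multiples of the gradient of `g`, so the
determinant vanishes; γ₂ i = 0 makes it γ₁ i γ₂ j times the old minor. -/
theorem dvd_mul_coeff_of_dvd {g : MvPolynomial (Fin n) K} (hg : Prime g)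
    (hmin : ¬ ∀ j, g ∣ jacobianMinor f j) {F₁ F₂ : MvPolynomial (Fin n) K}
    {γ₁ γ₂ : Fin m → MvPolynomial (Fin n) K}
    (hF₁ : ∀ k, pderiv k F₁ = ∑ l, γ₁ l * pderiv k (f l))
    (hF₂ : ∀ k, pderiv k F₂ = ∑ l, γ₂ l * pderiv k (f l)) {i j : Fin m} (hij : i ≠ j)
    (hi : γ₂ i = 0) (hg₁ : g ∣ F₁) (hg₂ : g ∣ F₂) : g ∣ γ₁ i * γ₂ j := by
  push Not at hmin
  obtain ⟨r, hr⟩ := hmin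
  refine (hg.dvd_or_dvd ?_).resolve_right hr
  have hF₂' : ∀ k, pderiv k F₂ = ∑ l, γ₂ l * pderiv k (Function.update f i F₁ l) := by
    intro k
    rw [hF₂]
    refine Finset.sum_congr rfl fun l _ => ?_
    rcases eq_or_ne l i with rfl | hl
    · simp [hi]
    · simp [hl]
  rw [mul_comm (γ₁ i), mul_assoc, ← jacobianMinor_update hF₁ i r, ← jacobianMinor_update hF₂' j r,
    ← Ideal.mem_span_singleton, ← Ideal.Quotient.eq_zero_iff_mem, jacobianMinor, RingHom.map_det]
  obtain ⟨u₁, rfl⟩ := hg₁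
  obtain ⟨u₂, rfl⟩ := hg₂
  have hg0 : Ideal.Quotient.mk (Ideal.span {g}) g = 0 := by
    simp
  refine Matrix.det_eq_zero_of_rows_eq_smul hij
    (w := fun k => Ideal.Quotient.mk (Ideal.span {g}) (pderiv (r k) g))
    (u := Ideal.Quotient.mk _ u₁) (v := Ideal.Quotient.mk _ u₂) ?_ ?_
  · ext k
    simp [hij, hg0]
  · ext k
    simp [hg0]

theorem squarefree_and_isFreeOf_of_jacobianMinor [IsDomain K]
    [UniqueFactorizationMonoid K] [CharP K p] (hn : 1 ≤ n) (hmin : ∀ g, Prime g → ¬ ∀ j, g ∣ jacobianMinor f j) {i : Fin m}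
    {b c : MvPolynomial (Fin n) K} (hb : b ∈ adjoinOmitting p f {i})
    (hc : c ∈ adjoinOmitting p f {i}) (hbc : IsRelPrime b c) :
    Squarefree (b * f i + c) ∧ IsFreeOf (powSubalgebra K n p) (b * f i + c) := by
  obtain ⟨γ, hγi, -, hγ⟩ := exists_gradient_mul_add (Set.mem_singleton i) hb hc
  have key : ∀ g, Prime g → g ∣ b * f i + c → ¬ ∀ k, g ∣ pderiv k (b * f i + c) := by
    intro g hg hgF hgd
    have hgb : g ∣ b := hγi ▸ dvd_coeff_of_dvd_gradient hg (hmin g hg) hγ hgd i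
    have hgc : g ∣ c := (dvd_add_right (dvd_mul_of_dvd_left hgb _)).1 hgF
    exact hg.not_isUnit (hbc hgb hgc)
  constructor
  · intro x hx
    refine (isUnit_or_exists_prime_dvd hn x).resolve_right ?_
    rintro ⟨g, hg, hgx⟩
    obtain ⟨q, hq⟩ := (mul_dvd_mul hgx hgx).trans hx
    refine key g hg ⟨g * q, by rw [hq]; ring⟩ fun k => ?_
    rw [hq, pderiv_mul, pderiv_mul]
    exact dvd_add (dvd_mul_of_dvd_left (dvd_add (dvd_mul_left _ _) (dvd_mul_right _ _)) _)
      (dvd_mul_of_dvd_left (dvd_mul_right _ _) _)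
  · intro h hh hF
    refine (isUnit_or_exists_prime_dvd hn h).resolve_right ?_
    rintro ⟨g, hg, hgh⟩
    refine key g hg (hgh.trans hF) fun k => ?_
    obtain ⟨q, hq⟩ := hF
    rw [hq, pderiv_mul, pderiv_eq_zero_of_mem_powSubalgebra hh k, zero_mul, zero_add]
    exact dvd_mul_of_dvd_left hgh _

theorem isRelPrime_of_jacobianMinor [IsDomain K]
    [UniqueFactorizationMonoid K] [CharP K p] (hn : 1 ≤ n) (hmin : ∀ g, Prime g → ¬ ∀ j, g ∣ jacobianMinor f j) {i j : Fin m} (hij : i ≠ j)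
    {b₁ b₂ c₁ c₂ : MvPolynomial (Fin n) K} (hb₁ : b₁ ∈ adjoinOmitting p f {i, j})
    (hb₂ : b₂ ∈ adjoinOmitting p f {i, j}) (hc₁ : c₁ ∈ adjoinOmitting p f {i, j})
    (hc₂ : c₂ ∈ adjoinOmitting p f {i, j}) (h₁ : IsRelPrime b₁ c₁) (h₂ : IsRelPrime b₂ c₂) :
    IsRelPrime (b₁ * f i + c₁) (b₂ * f j + c₂) := by
  intro x hx₁ hx₂
  refine (isUnit_or_exists_prime_dvd hn x).resolve_right ?_
  rintro ⟨g, hg, hgx⟩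
  obtain ⟨γ₁, hγ₁i, -, hγ₁⟩ := exists_gradient_mul_add (Set.mem_insert i {j}) hb₁ hc₁
  obtain ⟨γ₂, hγ₂j, hγ₂, hγ₂'⟩ :=
    exists_gradient_mul_add (Set.mem_insert_of_mem i (Set.mem_singleton j)) hb₂ hc₂
  have h := dvd_mul_coeff_of_dvd hg (hmin g hg) hγ₁ hγ₂' hij
    (hγ₂ i (Set.mem_insert i _) hij) (hgx.trans hx₁) (hgx.trans hx₂)
  rw [hγ₁i, hγ₂j] at h
  rcases hg.dvd_or_dvd h with h | h
  · exact hg.not_isUnit (h₁ h ((dvd_add_right (dvd_mul_of_dvd_left h _)).1 (hgx.trans hx₁)))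
  · exact hg.not_isUnit (h₂ h ((dvd_add_right (dvd_mul_of_dvd_left h _)).1 (hgx.trans hx₂)))

theorem not_dvd_jacobianMinor_of_squarefree [IsDomain K] [UniqueFactorizationMonoid K] [CharP K p]
    (hp : p.Prime) (hm : 1 ≤ m)
    (h₁ : ∀ i : Fin m, ∀ b ∈ adjoinOmitting p f {i}, ∀ c ∈ adjoinOmitting p f {i},
      b ≠ 0 → IsRelPrime b c →
        Squarefree (b * f i + c) ∧ IsFreeOf (powSubalgebra K n p) (b * f i + c))
    (h₂ : ∀ i j : Fin m, i ≠ j →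
      ∀ b₁ ∈ adjoinOmitting p f {i, j}, ∀ b₂ ∈ adjoinOmitting p f {i, j},
      ∀ c₁ ∈ adjoinOmitting p f {i, j}, ∀ c₂ ∈ adjoinOmitting p f {i, j},
        b₁ ≠ 0 → b₂ ≠ 0 → IsRelPrime b₁ c₁ → IsRelPrime b₂ c₂ →
          IsRelPrime (b₁ * f i + c₁) (b₂ * f j + c₂))
    {g : MvPolynomial (Fin n) K} (hg : Prime g) : ¬ ∀ j, g ∣ jacobianMinor f j := by
  intro hmin
  have hB : ∀ (s : Set (Fin m)), ∀ b ∈ powSubalgebra K n p, b ∈ adjoinOmitting p f s :=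
    fun s b hb => Subalgebra.algebraMap_mem _ (⟨b, hb⟩ : powSubalgebra K n p)
  -- The shift (t g) ^ p lies in B and is divisible by g ^ r for r ≤ p; only r = 1 and r = 2 are
  -- needed.
  have hfix : ∀ (s : Set (Fin m)), ∀ b ∈ powSubalgebra K n p, ∀ c ∈ adjoinOmitting p f s,
      ¬ g ∣ b → b ≠ 0 ∧ ∃ c' ∈ adjoinOmitting p f s, IsRelPrime b c' ∧
        ∀ a r, r ≤ p → g ^ r ∣ a + c → g ^ r ∣ a + c' := by
    intro s b hb c hc hgb
    obtain ⟨t, ht⟩ := exists_isRelPrime_add_pow hp.ne_zero c hg hgb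
    refine ⟨fun h0 => hgb (h0 ▸ dvd_zero g), c + (t * g) ^ p,
      Subalgebra.add_mem _ hc (hB s _ (pow_mem_powSubalgebra _)), ht, fun a r hr h => ?_⟩
    rw [← add_assoc]
    refine dvd_add h ((pow_dvd_pow g hr).trans ?_)
    rw [mul_pow]
    exact dvd_mul_left _ _
  rcases exists_dvd_mul_add hp hm hg hmin with
    ⟨i, j, hij, b₁, hb₁, b₂, hb₂, c₁, hc₁, c₂, hc₂, hgb₁, hgb₂, hd₁, hd₂⟩ |
    ⟨i, b, hb, c, hc, hgb, hd, hex⟩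
  · obtain ⟨hb₁0, c₁', hc₁', hrel₁, hdvd₁⟩ := hfix _ b₁ hb₁ c₁ hc₁ hgb₁
    obtain ⟨hb₂0, c₂', hc₂', hrel₂, hdvd₂⟩ := hfix _ b₂ hb₂ c₂ hc₂ hgb₂
    refine hg.not_isUnit (h₂ i j hij b₁ (hB _ _ hb₁) b₂ (hB _ _ hb₂) c₁' hc₁' c₂' hc₂' hb₁0 hb₂0
      hrel₁ hrel₂ ?_ ?_)
    · simpa using hdvd₁ (b₁ * f i) 1 hp.one_le (by simpa using hd₁)
    · simpa using hdvd₂ (b₂ * f j) 1 hp.one_le (by simpa using hd₂)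
  · obtain ⟨hb0, c', hc', hrel, hdvd⟩ := hfix _ b hb c hc hgb
    obtain ⟨hsq, hfree⟩ := h₁ i b (hB _ _ hb) c' hc' hb0 hrel
    rcases hex with hgB | hg2
    · refine hg.not_isUnit (hfree g hgB ?_)
      simpa using hdvd (b * f i) 1 hp.one_le (by simpa using hd)
    · refine hg.not_isUnit (hsq g ?_)
      rw [← pow_two]
      exact hdvd _ 2 hp.two_le hg2

end SquarefreeFree

/-! ### Differentiation along a p-basis of a ring of constants. -/

section PBasis

/-- Modulo `p`-th powers every polynomial expression is a combination of reduced monomials, and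
this is compatible with partial derivatives. -/
theorem exists_reduced_aeval {B A ι : Type*} [CommRing B] [CommRing A] [Algebra B A] [Fintype ι]
    [DecidableEq ι]
    {p : ℕ} (hp : 0 < p) (hpB : (p : B) = 0) (hpow : ∀ a : A, ∃ e : B, algebraMap B A e = a ^ p)
    (f : ι → A) (Φ : MvPolynomial ι B) :
    ∃ c : (ι → Fin p) → B, aeval f Φ = ∑ α, c α • ∏ i, f i ^ (α i : ℕ) ∧
      ∀ i, aeval f (pderiv i Φ) =
        ∑ α, c α • aeval f (pderiv i (∏ l, (X l : MvPolynomial ι B) ^ (α l : ℕ))) := by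
  induction Φ using MvPolynomial.induction_on' with
  | add P Q hP hQ =>
    obtain ⟨c, hc, hc'⟩ := hP
    obtain ⟨e, he, he'⟩ := hQ
    refine ⟨c + e, ?_, fun i => ?_⟩
    · simp [hc, he, add_smul, Finset.sum_add_distrib]
    · simp [hc', he', add_smul, Finset.sum_add_distrib]
  | monomial s r =>
    obtain ⟨e, he⟩ := hpow (∏ i, f i ^ (s i / p))
    have hmon : monomial s r = C r * (∏ i, (X i : MvPolynomial ι B) ^ (s i % p)) *
        (∏ i, (X i : MvPolynomial ι B) ^ (s i / p)) ^ p := by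
      rw [monomial_eq, Finsupp.prod_fintype _ _ (by simp), mul_assoc, ← Finset.prod_pow,
        ← Finset.prod_mul_distrib]
      congr 1
      refine Finset.prod_congr rfl fun i _ => ?_
      rw [← pow_mul, ← pow_add, mul_comm (s i / p), Nat.mod_add_div]
    have hpA : (p : MvPolynomial ι B) = 0 := by rw [← map_natCast C, hpB, map_zero]
    refine ⟨Pi.single (fun i => ⟨s i % p, Nat.mod_lt _ hp⟩) (r * e), ?_, fun i => ?_⟩
    · rw [Finset.sum_eq_single (fun i => ⟨s i % p, Nat.mod_lt _ hp⟩)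
        (fun α _ hα => by simp [hα]) (by simp), hmon]
      simp only [map_mul, map_prod, map_pow, aeval_X, aeval_C, Pi.single_eq_same, ← he,
        Algebra.smul_def]
      ring
    · rw [Finset.sum_eq_single (fun i => ⟨s i % p, Nat.mod_lt _ hp⟩)
        (fun α _ hα => by simp [hα]) (by simp), hmon]
      have h0 : pderiv i ((∏ i, (X i : MvPolynomial ι B) ^ (s i / p)) ^ p) = 0 := by
        rw [pderiv_pow, hpA, zero_mul, zero_mul]
      rw [pderiv_mul, h0, mul_zero, add_zero, pderiv_C_mul, map_mul, map_mul]
      simp only [map_prod, map_pow, aeval_X, aeval_C, Pi.single_eq_same, ← he, Algebra.smul_def,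
        map_mul]
      ring

/-- This makes ∂/∂f_i well defined: a relation among the f_i reduces to the zero combination of
reduced monomials, and the same coefficients compute its derivative. -/
theorem aeval_pderiv_eq_zero {B A ι : Type*} [CommRing B] [CommRing A] [Algebra B A] [Fintype ι]
    [DecidableEq ι]
    {p : ℕ} (hp : 0 < p) (hpB : (p : B) = 0) (hpow : ∀ a : A, ∃ e : B, algebraMap B A e = a ^ p)
    {f : ι → A} (hf : LinearIndependent B fun α : ι → Fin p => ∏ i, f i ^ (α i : ℕ))
    {Φ : MvPolynomial ι B} (hΦ : aeval f Φ = 0) (i : ι) : aeval f (pderiv i Φ) = 0 := by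
  obtain ⟨c, hc, hc'⟩ := exists_reduced_aeval hp hpB hpow f Φ
  have := Fintype.linearIndependent_iff.1 hf c (hc.symm.trans hΦ)
  rw [hc']
  exact Finset.sum_eq_zero fun α _ => by rw [this α, zero_smul]

variable {K : Type*} [CommRing K] {m n p : ℕ} {f : Fin m → MvPolynomial (Fin n) K}

theorem natCast_powSubalgebra_eq_zero [CharP K p] : (p : powSubalgebra K n p) = 0 :=
  Subtype.ext (by
    push_cast
    exact CharP.cast_eq_zero (MvPolynomial (Fin n) K) p)

theorem exists_algebraMap_eq_pow [IsDomain K] [CharP K p] (a : MvPolynomial (Fin n) K) :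
    ∃ e : powSubalgebra K n p, algebraMap _ (MvPolynomial (Fin n) K) e = a ^ p :=
  ⟨⟨a ^ p, pow_mem_powSubalgebra a⟩, rfl⟩

theorem aeval_C_powSubalgebra (b : powSubalgebra K n p) :
    aeval f (C b : MvPolynomial (Fin m) (powSubalgebra K n p)) = b :=
  aeval_C f b

theorem exists_aeval_eq_mul_add {s : Set (Fin m)} {i : Fin m} (hi : i ∈ s)
    {b c : MvPolynomial (Fin n) K} (hb : b ∈ powSubalgebra K n p)
    (hc : c ∈ adjoinOmitting p f s) :
    ∃ Φ : MvPolynomial (Fin m) (powSubalgebra K n p),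
      aeval f Φ = b * f i + c ∧ pderiv i Φ = C ⟨b, hb⟩ ∧ ∀ j ∈ s, j ≠ i → pderiv j Φ = 0 := by
  obtain ⟨Ψ, rfl, hΨ⟩ := exists_aeval_eq_of_mem_adjoinOmitting hc
  refine ⟨C ⟨b, hb⟩ * X i + Ψ, ?_, ?_, fun j hj hji => ?_⟩
  · rw [map_add, map_mul, aeval_C, aeval_X]
    rfl
  · rw [map_add, pderiv_C_mul, pderiv_X_self, hΨ i hi, mul_one, add_zero]
  · rw [map_add, pderiv_C_mul, pderiv_X_of_ne hji.symm, hΨ j hj, mul_zero, add_zero]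

theorem Derivation.eq_zero_of_mul_eq_zero {R A : Type*} [CommRing R] [CommRing A] [IsDomain A]
    [Algebra R A] {d : Derivation R A A} {x y : A} (hx : x ≠ 0) (hdx : d x = 0)
    (hdxy : d (x * y) = 0) : d y = 0 := by
  rw [Derivation.leibniz, hdx, smul_zero, add_zero, smul_eq_mul] at hdxy
  exact (mul_eq_zero.1 hdxy).resolve_left hx

namespace IsPBasis

variable {d : Derivation K (MvPolynomial (Fin n) K) (MvPolynomial (Fin n) K)}

theorem exists_aeval_eq (hf : IsPBasis p (powSubalgebra K n p) (ringOfConstants d) f)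
    {h : MvPolynomial (Fin n) K} (hh : d h = 0) :
    ∃ Φ : MvPolynomial (Fin m) (powSubalgebra K n p), aeval f Φ = h := by
  have h1 : h ∈ (ringOfConstants d : Set (MvPolynomial (Fin n) K)) := hh
  rw [← hf.2] at h1
  have h2 : Submodule.span (powSubalgebra K n p)
      (Set.range fun α : Fin m → Fin p => ∏ i, f i ^ (α i : ℕ)) ≤
      (aeval f : MvPolynomial (Fin m) (powSubalgebra K n p) →ₐ[_] _).toLinearMap.range := by
    rw [Submodule.span_le]
    rintro _ ⟨α, rfl⟩
    exact ⟨∏ i, X i ^ (α i : ℕ), by simp⟩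
  exact h2 h1

variable [IsDomain K] [CharP K p]

theorem derivation_aeval (hp : p.Prime)
    (hf : IsPBasis p (powSubalgebra K n p) (ringOfConstants d) f)
    (Φ : MvPolynomial (Fin m) (powSubalgebra K n p)) : d (aeval f Φ) = 0 := by
  obtain ⟨c, hc, -⟩ := exists_reduced_aeval hp.pos natCast_powSubalgebra_eq_zero
    exists_algebraMap_eq_pow f Φ
  have : aeval f Φ ∈ (ringOfConstants d : Set (MvPolynomial (Fin n) K)) := by
    rw [← hf.2, hc]
    exact Submodule.sum_mem _ fun α _ =>
      Submodule.smul_mem _ _ (Submodule.subset_span ⟨α, rfl⟩)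
  exact this

theorem derivation_eq_zero_of_mem (hp : p.Prime)
    (hf : IsPBasis p (powSubalgebra K n p) (ringOfConstants d) f)
    {b : MvPolynomial (Fin n) K} (hb : b ∈ powSubalgebra K n p) : d b = 0 := by
  have h := hf.derivation_aeval hp (C ⟨b, hb⟩)
  rwa [aeval_C_powSubalgebra] at h

theorem aeval_pderiv_congr (hp : p.Prime)
    (hf : IsPBasis p (powSubalgebra K n p) (ringOfConstants d) f)
    {Φ Ψ : MvPolynomial (Fin m) (powSubalgebra K n p)} (h : aeval f Φ = aeval f Ψ) (i : Fin m) :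
    aeval f (pderiv i Φ) = aeval f (pderiv i Ψ) := by
  have := aeval_pderiv_eq_zero hp.pos natCast_powSubalgebra_eq_zero exists_algebraMap_eq_pow
    hf.1 (Φ := Φ - Ψ) (by rw [map_sub, h, sub_self]) i
  rwa [map_sub, map_sub, sub_eq_zero] at this

/-- The cofactor of q is again a constant, so ∂/∂f_i may be applied to the factorization; q passes
through it and `g` would divide the derivative. -/
theorem not_dvd_aeval (hp : p.Prime)
    (hf : IsPBasis p (powSubalgebra K n p) (ringOfConstants d) f)
    {g q : MvPolynomial (Fin n) K} {Φ : MvPolynomial (Fin m) (powSubalgebra K n p)} {i : Fin m}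
    (hb : ¬ g ∣ aeval f (pderiv i Φ)) (hq : q ∈ powSubalgebra K n p) (hq0 : q ≠ 0) (hgq : g ∣ q) :
    ¬ q ∣ aeval f Φ := by
  rintro ⟨H, hH⟩
  obtain ⟨η, rfl⟩ := hf.exists_aeval_eq
    (Derivation.eq_zero_of_mul_eq_zero hq0 (hf.derivation_eq_zero_of_mem hp hq)
      (hH ▸ hf.derivation_aeval hp Φ))
  have h1 := hf.aeval_pderiv_congr hp (Φ := Φ) (Ψ := C ⟨q, hq⟩ * η)
    (by rw [hH, map_mul, aeval_C_powSubalgebra]) i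
  rw [pderiv_C_mul, map_mul, aeval_C_powSubalgebra] at h1
  exact hb (h1 ▸ dvd_mul_of_dvd_left hgq _)

theorem not_sq_dvd_aeval [UniqueFactorizationMonoid K] (hp : p.Prime)
    (hf : IsPBasis p (powSubalgebra K n p) (ringOfConstants d) f)
    {g : MvPolynomial (Fin n) K} (hg : Prime g)
    {Φ : MvPolynomial (Fin m) (powSubalgebra K n p)} {i : Fin m}
    (hb : ¬ g ∣ aeval f (pderiv i Φ)) : ¬ g ^ 2 ∣ aeval f Φ := by
  intro hg2
  have hgpF := hf.not_dvd_aeval hp hb (pow_mem_powSubalgebra g)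
    (pow_ne_zero _ hg.ne_zero) (dvd_pow_self g hp.ne_zero)
  have hF0 : aeval f Φ ≠ 0 := fun h => hgpF (h ▸ dvd_zero _)
  -- Here 2 ≤ s < p, so s k = 1 + p l is solvable. Dividing the k-th power of g ^ s * u by the p-th
  -- power of g ^ l yields a constant g * u ^ k in which `g` occurs once.
  obtain ⟨s, u, hu, hF⟩ := WfDvdMonoid.max_power_factor hF0 hg.irreducible
  have hsp : s < p := by
    by_contra hcon
    exact hgpF (hF ▸ dvd_mul_of_dvd_left (pow_dvd_pow g (not_lt.1 hcon)) u)
  have hs2 : 2 ≤ s := by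
    by_contra hcon
    have h1 : g ^ (s + 1) ∣ g ^ s * u := hF ▸ (pow_dvd_pow g (by omega)).trans hg2
    rw [pow_succ] at h1
    exact hu ((mul_dvd_mul_iff_left (pow_ne_zero s hg.ne_zero)).1 h1)
  have hcop : Nat.Coprime s p := (Nat.coprime_of_lt_prime (by omega) hsp hp).symm
  obtain ⟨k, l, hkl⟩ : ∃ k l, s * k = 1 + p * l := by
    obtain ⟨k, -, hk⟩ := Nat.exists_mul_mod_eq_one_of_coprime hcop hp.one_lt
    exact ⟨k, s * k / p, by rw [← hk, Nat.mod_add_div]⟩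
  have hu0 : u ≠ 0 := fun h => hu (h ▸ dvd_zero g)
  have hG0 : g * u ^ k ≠ 0 := mul_ne_zero hg.ne_zero (pow_ne_zero _ hu0)
  have hG : d (g * u ^ k) = 0 := by
    refine Derivation.eq_zero_of_mul_eq_zero (x := (g ^ l) ^ p)
      (pow_ne_zero _ (pow_ne_zero _ hg.ne_zero))
      (hf.derivation_eq_zero_of_mem hp (pow_mem_powSubalgebra _)) ?_
    have h1 : (g ^ l) ^ p * (g * u ^ k) = aeval f (Φ ^ k) := by
      rw [map_pow, hF, mul_pow, ← pow_mul g s k, hkl]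
      ring
    rw [h1]
    exact hf.derivation_aeval hp _
  -- Up to a p-th power prime to `g`, this factors g ^ s * u into two constants, both divisible by
  -- `g` because s ≥ 2; the product rule then keeps a factor `g`.
  have hGH : (g * u ^ k) * (g ^ (s - 1) * u * (u ^ k) ^ (p - 1)) =
      aeval f (Φ * C ⟨(u ^ k) ^ p, pow_mem_powSubalgebra _⟩) := by
    obtain ⟨s, rfl⟩ : ∃ s', s = s' + 1 := ⟨s - 1, by omega⟩
    obtain ⟨q, rfl⟩ : ∃ q, p = q + 1 := ⟨p - 1, by omega⟩
    rw [map_mul, aeval_C_powSubalgebra, hF, Nat.add_sub_cancel, Nat.add_sub_cancel]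
    ring
  obtain ⟨Γ, hΓ⟩ := hf.exists_aeval_eq hG
  obtain ⟨η, hη⟩ := hf.exists_aeval_eq
    (Derivation.eq_zero_of_mul_eq_zero hG0 hG (hGH ▸ hf.derivation_aeval hp _))
  have h1 := hf.aeval_pderiv_congr hp (Φ := Γ * η)
    (Ψ := Φ * C ⟨(u ^ k) ^ p, pow_mem_powSubalgebra _⟩) (by rw [← hGH, map_mul, hΓ, hη]) i
  rw [pderiv_mul, pderiv_mul, pderiv_C, mul_zero, add_zero, map_add, map_mul, map_mul, map_mul,
    hΓ, hη, aeval_C_powSubalgebra] at h1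
  have h2 : g ∣ aeval f (pderiv i Φ) * (u ^ k) ^ p := by
    have h3 : g ∣ aeval f (pderiv i Γ) * (g ^ (s - 1) * u * (u ^ k) ^ (p - 1)) +
        g * u ^ k * aeval f (pderiv i η) :=
      dvd_add (dvd_mul_of_dvd_right (dvd_mul_of_dvd_left (dvd_mul_of_dvd_left
        (dvd_pow_self g (by omega)) _) _) _) (dvd_mul_of_dvd_left (dvd_mul_right _ _) _)
    exact h1 ▸ h3
  rcases hg.dvd_or_dvd h2 with h3 | h3
  · exact hb h3
  · exact hu (hg.dvd_of_dvd_pow (hg.dvd_of_dvd_pow h3))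

theorem not_dvd_jacobianMinor [UniqueFactorizationMonoid K] (hp : p.Prime) (hm : 1 ≤ m)
    (hf : IsPBasis p (powSubalgebra K n p) (ringOfConstants d) f)
    {g : MvPolynomial (Fin n) K} (hg : Prime g) : ¬ ∀ j, g ∣ jacobianMinor f j := by
  intro hmin
  rcases exists_dvd_mul_add hp hm hg hmin with
    ⟨i, j, hij, b₁, hb₁, b₂, hb₂, c₁, hc₁, c₂, hc₂, hgb₁, hgb₂, hd₁, hd₂⟩ |
    ⟨i, b, hb, c, hc, hgb, hd, hex⟩
  · obtain ⟨Φ₁, hΦ₁, hΦ₁i, hΦ₁'⟩ :=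
      exists_aeval_eq_mul_add (i := i) (by simp) hb₁ hc₁
    obtain ⟨Φ₂, hΦ₂, hΦ₂j, -⟩ :=
      exists_aeval_eq_mul_add (i := j) (by simp) hb₂ hc₂
    have hΦ₁j : pderiv j Φ₁ = 0 := hΦ₁' j (by simp) hij.symm
    rw [← hΦ₁] at hd₁
    rw [← hΦ₂] at hd₂
    have hsq₁ := hf.not_sq_dvd_aeval hp hg (Φ := Φ₁) (i := i) (by rwa [hΦ₁i, aeval_C_powSubalgebra])
    obtain ⟨u₁, hu₁⟩ := hd₁
    obtain ⟨u₂, hu₂⟩ := hd₂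
    have hgu₁ : ¬ g ∣ u₁ := fun h => hsq₁ (by
      rw [hu₁, pow_two]
      exact mul_dvd_mul_left g h)
    have hΦ₁0 : aeval f Φ₁ ≠ 0 := fun h => hsq₁ (h ▸ dvd_zero _)
    -- Multiplying F₂ / F₁ = u₂ / u₁ by u₁ ^ p gives a constant cofactor in A. Applying ∂/∂f_j,
    -- which kills F₁, shows that F₁, hence `g`, divides b₂ u₁ ^ p.
    have hprod : aeval f Φ₁ * (u₂ * u₁ ^ (p - 1)) =
        aeval f (Φ₂ * C ⟨u₁ ^ p, pow_mem_powSubalgebra _⟩) := by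
      obtain ⟨q, rfl⟩ : ∃ q, p = q + 1 := ⟨p - 1, by have := hp.pos; omega⟩
      rw [map_mul, aeval_C_powSubalgebra, hu₁, hu₂, Nat.add_sub_cancel]
      ring
    obtain ⟨η, hη⟩ := hf.exists_aeval_eq (Derivation.eq_zero_of_mul_eq_zero hΦ₁0
      (hf.derivation_aeval hp _) (hprod ▸ hf.derivation_aeval hp _))
    have h1 := hf.aeval_pderiv_congr hp (Φ := Φ₁ * η)
      (Ψ := Φ₂ * C ⟨u₁ ^ p, pow_mem_powSubalgebra _⟩) (by rw [← hprod, map_mul, hη]) j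
    rw [pderiv_mul, pderiv_mul, pderiv_C, hΦ₁j, hΦ₂j, mul_zero, zero_mul, zero_add, add_zero,
      map_mul, map_mul, aeval_C_powSubalgebra, aeval_C_powSubalgebra, hu₁, mul_assoc] at h1
    rcases hg.dvd_or_dvd (Dvd.intro _ h1) with h2 | h2
    · exact hgb₂ h2
    · exact hgu₁ (hg.dvd_of_dvd_pow h2)
  · obtain ⟨Φ, hΦ, hΦi, -⟩ := exists_aeval_eq_mul_add (Set.mem_singleton i) hb hc
    have hb' : ¬ g ∣ aeval f (pderiv i Φ) := by rwa [hΦi, aeval_C_powSubalgebra]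
    rcases hex with hgB | hg2
    · exact hf.not_dvd_aeval hp hb' hgB hg.ne_zero dvd_rfl (hΦ ▸ hd)
    · exact hf.not_sq_dvd_aeval hp hg hb' (hΦ ▸ hg2)

end IsPBasis

end PBasis

/-! ### Coefficientwise divisibility by elements of B, and eigenvectors. -/

section Construction

theorem dvd_of_forall_dvd_mul {R ι : Type*} [CommRing R] [IsDomain R] [UniqueFactorizationMonoid R]
    [Fintype ι] {a : ι → R} (ha : ∀ g, Prime g → ¬ ∀ j, g ∣ a j) (ha0 : ∃ j, a j ≠ 0) {b c : R}
    (h : ∀ j, b ∣ c * a j) : b ∣ c := by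
  classical
  let _ : StrongNormalizationMonoid R := UniqueFactorizationMonoid.strongNormalizationMonoid
  let _ : NormalizedGCDMonoid R := UniqueFactorizationMonoid.toNormalizedGCDMonoid _
  have h1 : b ∣ c * Finset.univ.gcd a :=
    (Finset.dvd_gcd fun j _ => h j).trans (Finset.gcd_mul_left' Finset.univ a c).dvd
  have h2 : IsUnit (Finset.univ.gcd a) := by
    by_contra hu
    have h0 : Finset.univ.gcd a ≠ 0 := by
      rw [Ne, Finset.gcd_eq_zero_iff]
      obtain ⟨j, hj⟩ := ha0
      exact fun h => hj (h j (Finset.mem_univ j))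
    obtain ⟨g, hg, hga⟩ := WfDvdMonoid.exists_irreducible_factor hu h0
    exact ha g hg.prime fun j => hga.trans (Finset.gcd_dvd (Finset.mem_univ j))
  exact h2.dvd_mul_right.1 h1

theorem dvd_aeval_of_dvd_coeff {B A ι : Type*} [CommRing B] [CommRing A] [Algebra B A] {f : ι → A}
    {b : A} {Φ : MvPolynomial ι B} (h : ∀ s, b ∣ algebraMap B A (coeff s Φ)) :
    b ∣ aeval f Φ := by
  rw [Φ.as_sum, map_sum]
  refine Finset.dvd_sum fun s _ => ?_
  rw [aeval_monomial]
  exact dvd_mul_of_dvd_left (h s) _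

variable {K : Type*} [CommRing K] {m n p : ℕ} {f : Fin m → MvPolynomial (Fin n) K}

/-- Elements of B pass through derivatives, so b divides the gradient of Φ(f); by Cramer and `hdiv`
it divides each (∂Φ/∂X_i)(f). Induct on the degree: the exponents are below p, hence invertible when
nonzero, and only the constant term is left, by subtraction. -/
theorem dvd_coeff_of_dvd_aeval [CharP K p] (hp : p.Prime) {b : MvPolynomial (Fin n) K}
    (hb : b ∈ powSubalgebra K n p) (hdiv : ∀ c, (∀ j, b ∣ c * jacobianMinor f j) → b ∣ c)
    (Φ : MvPolynomial (Fin m) (powSubalgebra K n p)) (hΦ : ∀ s ∈ Φ.support, ∀ i, s i < p)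
    (h : b ∣ aeval f Φ) (s : Fin m →₀ ℕ) :
    b ∣ ((coeff s Φ : powSubalgebra K n p) : MvPolynomial (Fin n) K) := by
  induction hN : Φ.totalDegree using Nat.strong_induction_on generalizing Φ s with
  | _ N ih =>
    have hder : ∀ i s, b ∣ ((coeff s (pderiv i Φ) : powSubalgebra K n p) : MvPolynomial (Fin n) K) := by
      intro i s
      by_cases h0 : pderiv i Φ = 0
      · rw [h0, coeff_zero]
        exact dvd_zero b
      refine ih _ (hN ▸ totalDegree_pderiv_lt h0) (pderiv i Φ) (fun t ht l => ?_)
        (hdiv _ fun j => ?_) s rfl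
      · have ht' : t + Finsupp.single i 1 ∈ Φ.support := by
          rw [mem_support_iff] at ht ⊢
          rw [coeff_pderiv] at ht
          exact left_ne_zero_of_mul ht
        refine lt_of_le_of_lt ?_ (hΦ _ ht' l)
        simp
      · rw [← jacobianMinor_update (pderiv_aeval_powSubalgebra Φ) i j]
        obtain ⟨q, hq⟩ := h
        have hgrad : ∀ k, pderiv k (b * q) = ∑ l, (Pi.single i b : Fin m → _) l *
            pderiv k (Function.update f i q l) := by
          intro k
          rw [Finset.sum_eq_single i (fun l _ hl => by simp [hl]) (by simp), pderiv_mul,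
            pderiv_eq_zero_of_mem_powSubalgebra hb k]
          simp
        have h2 := jacobianMinor_update hgrad i j
        rw [Function.update_idem] at h2
        rw [hq, h2, Pi.single_eq_same]
        exact dvd_mul_right b _
    have hpos : ∀ s ≠ 0, b ∣ ((coeff s Φ : powSubalgebra K n p) : MvPolynomial (Fin n) K) := by
      intro s hs
      by_cases hsupp : s ∈ Φ.support
      · obtain ⟨i, hi⟩ := Finsupp.ne_iff.1 hs
        have hi0 : s i ≠ 0 := hi
        have h1 := hder i (s - Finsupp.single i 1)
        have h2 : s - Finsupp.single i 1 + Finsupp.single i 1 = s :=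
          tsub_add_cancel_of_le (by simpa [Nat.one_le_iff_ne_zero] using hi0)
        have h3 : (s - Finsupp.single i 1 : Fin m →₀ ℕ) i + 1 = s i := by
          simp; omega
        rw [coeff_pderiv, h2, ← Nat.cast_succ, Nat.succ_eq_add_one, h3] at h1
        have hunit : IsUnit ((s i : ℕ) : MvPolynomial (Fin n) K) :=
          (CharP.isUnit_natCast_iff hp).2 fun hdvd =>
            absurd (Nat.le_of_dvd (Nat.pos_of_ne_zero hi0) hdvd) (not_le.2 (hΦ s hsupp i))
        push_cast at h1
        exact hunit.dvd_mul_right.1 h1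
      · rw [notMem_support_iff.1 hsupp]
        exact dvd_zero b
    rcases eq_or_ne s 0 with rfl | hs
    · have h1 : b ∣ aeval f (Φ - C (coeff 0 Φ)) := by
        refine dvd_aeval_of_dvd_coeff fun t => ?_
        rcases eq_or_ne t 0 with rfl | ht
        · simp
        · rw [coeff_sub, coeff_C, if_neg ht.symm, sub_zero]
          exact hpos t ht
      rw [map_sub, aeval_C_powSubalgebra] at h1
      exact (dvd_sub_right h).1 h1
    · exact hpos s hs

/-- Serves twice: with b = 0 it is linear independence, with b ≠ 0 it cancels denominators. -/
theorem dvd_of_dvd_sum_smul [CharP K p] (hp : p.Prime) {b : MvPolynomial (Fin n) K}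
    (hb : b ∈ powSubalgebra K n p) (hdiv : ∀ c, (∀ j, b ∣ c * jacobianMinor f j) → b ∣ c)
    {c : (Fin m → Fin p) → powSubalgebra K n p} (h : b ∣ ∑ α, c α • ∏ i, f i ^ (α i : ℕ))
    (α : Fin m → Fin p) : b ∣ (c α : MvPolynomial (Fin n) K) := by
  classical
  let e : (Fin m → Fin p) → Fin m →₀ ℕ := fun α => Finsupp.equivFunOnFinite.symm fun i => (α i : ℕ)
  have he : Function.Injective e := fun α β hαβ => by
    funext i
    exact Fin.ext (DFunLike.congr_fun hαβ i)
  let Φ : MvPolynomial (Fin m) (powSubalgebra K n p) := ∑ α, monomial (e α) (c α)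
  have hcoeff : ∀ s, coeff s Φ = ∑ α, if e α = s then c α else 0 := fun s => by
    simp [Φ, coeff_sum, coeff_monomial]
  have hΦα : coeff (e α) Φ = c α := by
    rw [hcoeff, Finset.sum_eq_single α (fun β _ hβ => if_neg fun h => hβ (he h)) (by simp),
      if_pos rfl]
  rw [← hΦα]
  refine dvd_coeff_of_dvd_aeval hp hb hdiv Φ (fun s hs i => ?_) ?_ _
  · by_contra hcon
    refine mem_support_iff.1 hs ?_
    rw [hcoeff]
    refine Finset.sum_eq_zero fun β _ => if_neg ?_
    rintro rfl
    exact hcon (β i).2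
  · have : aeval f Φ = ∑ α, c α • ∏ i, f i ^ (α i : ℕ) := by
      simp only [Φ, map_sum, aeval_monomial, Algebra.smul_def]
      refine Finset.sum_congr rfl fun β _ => ?_
      rw [Finsupp.prod_fintype _ _ (by simp)]
      rfl
    rwa [this]

/-- Eigenvectors of an additive map for distinct eigenvalues are independent. -/
theorem eq_zero_of_sum_eigenvectors_eq_zero {L ι : Type*} [Field L] {δ : L →+ L} {μ : ι → L}
    (hμ : Function.Injective μ) (hδ : ∀ i x, δ (μ i * x) = μ i * δ x) (S : Finset ι) {v : ι → L}
    (hv : ∀ i ∈ S, δ (v i) = μ i * v i) (hsum : ∑ i ∈ S, v i = 0) : ∀ i ∈ S, v i = 0 := by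
  classical
  induction S using Finset.induction_on generalizing v with
  | empty => simp
  | insert a S ha ih =>
    rw [Finset.sum_insert ha] at hsum
    -- Apply δ and subtract μ a times the relation to eliminate v a.
    have h1 : ∑ i ∈ S, (μ i - μ a) * v i = 0 := by
      have h2 := congrArg δ hsum
      rw [map_add, map_sum, map_zero, hv a (Finset.mem_insert_self a S),
        Finset.sum_congr rfl fun i hi => hv i (Finset.mem_insert_of_mem hi)] at h2
      simp only [sub_mul, Finset.sum_sub_distrib, ← Finset.mul_sum]
      linear_combination h2 - μ a * hsum
    have h3 : ∀ i ∈ S, v i = 0 := by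
      intro i hi
      have h4 := ih (v := fun i => (μ i - μ a) * v i) (fun i hi => by
        rw [sub_mul, map_sub, hδ, hδ, hv i (Finset.mem_insert_of_mem hi)]
        ring) h1 i hi
      refine (mul_eq_zero.1 h4).resolve_left (sub_ne_zero.2 fun h => ?_)
      exact ha (hμ h ▸ hi)
    intro i hi
    rcases Finset.mem_insert.1 hi with rfl | hi
    · rwa [Finset.sum_eq_zero h3, add_zero] at hsum
    · exact h3 i hi

theorem Derivation.map_prod_pow_of_eigen {L ι : Type*} [CommRing L] (δ : Derivation ℤ L L)
    {x μ : ι → L} (S : Finset ι) (hx : ∀ i ∈ S, δ (x i) = μ i * x i) (k : ι → ℕ) :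
    δ (∏ i ∈ S, x i ^ k i) = (∑ i ∈ S, k i * μ i) * ∏ i ∈ S, x i ^ k i := by
  classical
  induction S using Finset.induction_on with
  | empty => simp
  | insert a S ha ih =>
    have hpow : ∀ k : ℕ, δ (x a ^ k) = k * μ a * x a ^ k := by
      intro k
      induction k with
      | zero => simp
      | succ k hk =>
        rw [pow_succ, Derivation.leibniz, hk, hx a (Finset.mem_insert_self a S)]
        push_cast
        simp only [smul_eq_mul]
        ring
    rw [Finset.prod_insert ha, Finset.sum_insert ha, Derivation.leibniz, hpow,
      ih fun i hi => hx i (Finset.mem_insert_of_mem hi)]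
    simp only [smul_eq_mul]
    ring

end Construction

/-! ### Derivations with prescribed eigenvalues and their constants. -/

section Constants

theorem injective_sum_natCast_mul_X_pow {σ R : Type*} [CommRing R] {p : ℕ} [CharP R p] (hp : 0 < p)
    (x : σ) {ι : Type*} [Fintype ι] {r : ι → ℕ} (hr : Function.Injective r) :
    Function.Injective fun α : ι → Fin p =>
      ∑ t, ((α t : ℕ) : MvPolynomial σ R) * (X x ^ r t) ^ p := by
  classical
  have hcoeff : ∀ (α : ι → Fin p) t, coeff (Finsupp.single x (r t * p))
      (∑ t, ((α t : ℕ) : MvPolynomial σ R) * (X x ^ r t) ^ p) = ((α t : ℕ) : R) := by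
    intro α t
    rw [coeff_sum, Finset.sum_eq_single t]
    · rw [← map_natCast C, coeff_C_mul, ← pow_mul, coeff_X_pow, if_pos rfl, mul_one]
    · intro l _ hl
      rw [← map_natCast C, coeff_C_mul, ← pow_mul, coeff_X_pow, if_neg, mul_zero]
      intro h
      exact hl (hr (Nat.eq_of_mul_eq_mul_right hp (Finsupp.single_injective x h)))
    · simp
  intro α β h
  funext t
  have h1 := congrArg (coeff (Finsupp.single x (r t * p))) h
  simp only [hcoeff] at h1
  exact Fin.ext (CharP.natCast_injOn_Iio R p (α t).2 (β t).2 h1)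

/-- If a derivation acts on the members of a family `y` as multiplication by constants `c`, whose
reduced combinations are distinct, then the constants in `B[y]` all come from `B`. -/
theorem exists_algebraMap_eq_of_derivation_eq_zero {A B L ι : Type*} [CommRing A] [CommRing B]
    [Algebra B A] [Field L] [Fintype ι] [DecidableEq ι] {p : ℕ} (hp : 0 < p) (hpB : (p : B) = 0)
    (hpow : ∀ a : A, ∃ e : B, algebraMap B A e = a ^ p) {φ : A →+* L}
    (hφ : Function.Injective φ) {δ : Derivation ℤ L L} (hδB : ∀ b, δ (φ (algebraMap B A b)) = 0)
    {y c : ι → A} (hδc : ∀ t, δ (φ (c t)) = 0) (hδy : ∀ t, δ (φ (y t)) = φ (c t) * φ (y t))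
    (hc : Function.Injective fun α : ι → Fin p => ∑ t, ((α t : ℕ) : A) * c t)
    {Φ : MvPolynomial ι B} (hΦ : δ (φ (aeval y Φ)) = 0) : ∃ b, algebraMap B A b = aeval y Φ := by
  obtain ⟨q, hq, -⟩ := exists_reduced_aeval hp hpB hpow y Φ
  let μ : (ι → Fin p) → L := fun α => φ (∑ t, ((α t : ℕ) : A) * c t)
  have hμ : Function.Injective μ := hφ.comp hc
  have hδμ : ∀ α x, δ (μ α * x) = μ α * δ x := by
    intro α x
    have h1 : δ (μ α) = 0 := by simp [μ, hδc]
    rw [Derivation.leibniz, h1, smul_zero, add_zero, smul_eq_mul]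
  have hw : ∀ α, δ (φ (q α • ∏ i, y i ^ (α i : ℕ))) = μ α * φ (q α • ∏ i, y i ^ (α i : ℕ)) := by
    intro α
    have h1 := Derivation.map_prod_pow_of_eigen δ Finset.univ (fun t _ => hδy t)
      fun t => (α t : ℕ)
    have h2 : μ α = ∑ t, ((α t : ℕ) : L) * φ (c t) := by simp [μ]
    rw [Algebra.smul_def, map_mul, Derivation.leibniz, hδB, smul_zero, add_zero, map_prod]
    simp only [map_pow, h1, h2, smul_eq_mul]
    ring
  -- Applying δ to the reduced form gives a vanishing sum of eigenvectors. Each term is 0, and μ α =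
  -- 0 only for α = 0, so just the coefficient at α = 0 survives.
  have hsum : ∑ α, μ α * φ (q α • ∏ i, y i ^ (α i : ℕ)) = 0 := by
    rw [← Finset.sum_congr rfl fun α _ => hw α, ← map_sum, ← map_sum, ← hq]
    exact hΦ
  have hzero := eq_zero_of_sum_eigenvectors_eq_zero (δ := (δ : L →+ L)) hμ hδμ Finset.univ
    (v := fun α => μ α * φ (q α • ∏ i, y i ^ (α i : ℕ)))
    (fun α _ => by
      change δ _ = _
      rw [hδμ, hw]) hsum
  let o : ι → Fin p := fun _ => ⟨0, hp⟩
  have hμo : μ o = 0 := by simp [μ, o]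
  refine ⟨q o, ?_⟩
  rw [hq, Finset.sum_eq_single o (fun α _ hα => hφ ?_) (by simp), Algebra.smul_def]
  · simp [o]
  · rw [map_zero]
    exact (mul_eq_zero.1 (hzero α (Finset.mem_univ α))).resolve_left fun h =>
      hα (hμ (h.trans hμo.symm))

/-- The eigenvector argument, with B[s₀] as the ring of coefficients in place of B. -/
theorem mem_adjoin_of_derivation_eq_zero {K A L ι : Type*} [CommRing K] [CommRing A] [Algebra K A]
    [Field L] [DecidableEq ι] {p : ℕ} {B : Subalgebra K A} (hp : 0 < p) (hpA : (p : A) = 0)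
    (hB : ∀ a : A, a ^ p ∈ B) {φ : A →+* L} (hφ : Function.Injective φ) {s₀ : Set A}
    {y c : ι → A} {T : Finset ι} {δ : Derivation ℤ L L}
    (hδ : ∀ h ∈ Algebra.adjoin B s₀, δ (φ h) = 0)
    (hδy : ∀ t ∈ T, δ (φ (y t)) = φ (c t) * φ (y t)) (hδc : ∀ t, δ (φ (c t)) = 0)
    (hc : Function.Injective fun α : T → Fin p => ∑ t, ((α t : ℕ) : A) * c t)
    {e : A} (he : e ∈ Algebra.adjoin B (s₀ ∪ y '' T)) (hδe : δ (φ e) = 0) :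
    e ∈ Algebra.adjoin B s₀ := by
  have he' : e ∈ (Algebra.adjoin (Algebra.adjoin B s₀) (y '' T)).restrictScalars B :=
    Algebra.adjoin_union_eq_adjoin_adjoin B s₀ (y '' T) ▸ he
  rw [Subalgebra.mem_restrictScalars, Set.image_eq_range,
    Algebra.adjoin_range_eq_range_aeval] at he'
  obtain ⟨Φ, hΦ⟩ := he'
  replace hΦ : aeval (fun t : T => y t) Φ = e := hΦ
  have hpow : ∀ a : A, ∃ r : Algebra.adjoin B s₀, algebraMap (Algebra.adjoin B s₀) A r = a ^ p :=
    fun a => ⟨⟨a ^ p, (Algebra.adjoin B s₀).algebraMap_mem ⟨a ^ p, hB a⟩⟩, rfl⟩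
  have hp0 : (p : Algebra.adjoin B s₀) = 0 := Subtype.ext (by push_cast; exact hpA)
  obtain ⟨q, hq⟩ := exists_algebraMap_eq_of_derivation_eq_zero hp hp0 hpow hφ
    (fun r => hδ r r.2) (y := fun t : T => y t) (c := fun t : T => c t) (fun t => hδc t)
    (fun t => hδy t t.2) hc (Φ := Φ) (by rw [hΦ, hδe])
  rw [← hΦ, ← hq]
  exact q.2

/-- A derivation over the field of fractions of `B[s₀]` that acts on a generating subfamily of a
family `y` as multiplication by given elements. -/
theorem exists_finset_derivation_eigen {K A L ι : Type*} [CommRing K] [CommRing A] [Algebra K A]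
    [Field L] [Fintype ι] {p : ℕ} {B : Subalgebra K A} (hp : p.Prime) [CharP L p]
    (hB : ∀ a : A, a ^ p ∈ B) (φ : A →+* L) (hL : ∀ x : L, ∃ a b, φ b ≠ 0 ∧ φ b * x = φ a)
    (s₀ : Set A) (y c : ι → A) :
    ∃ (T : Finset ι) (δ : Derivation ℤ L L),
      (∀ i, φ (y i) ∈ fractionSubfield hp.ne_zero hB φ (Algebra.adjoin B (s₀ ∪ y '' T))) ∧
      (∀ h ∈ Algebra.adjoin B s₀, δ (φ h) = 0) ∧ ∀ t ∈ T, δ (φ (y t)) = φ (c t) * φ (y t) := by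
  obtain ⟨T, hT, hD⟩ := exists_finset_derivation hp hB φ hL s₀ y
  choose! D hDB hDs hDT hDt using hD
  -- The coefficients rescale the separating derivations so that y t has eigenvalue c t.
  let δ : Derivation ℤ L L := ∑ t ∈ T, (φ (c t) * φ (y t) / D t (φ (y t))) • D t
  have hδ : ∀ x, δ x = ∑ t ∈ T, φ (c t) * φ (y t) / D t (φ (y t)) * D t x := by
    intro x
    have h1 := congrFun (map_sum (Derivation.coeFnAddMonoidHom (R := ℤ) (A := L) (M := L))
      (fun t => (φ (c t) * φ (y t) / D t (φ (y t))) • D t) T) x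
    rwa [Finset.sum_apply] at h1
  refine ⟨T, δ, hT, fun h hh => ?_, fun t ht => ?_⟩
  · induction hh using Algebra.adjoin_induction with
    | mem x hx =>
      rw [hδ]
      exact Finset.sum_eq_zero fun t ht => by rw [hDs t ht x hx, mul_zero]
    | algebraMap b =>
      rw [hδ]
      exact Finset.sum_eq_zero fun t ht => mul_eq_zero_of_right _ (hDB t ht b b.2)
    | add x y _ _ hx hy => rw [map_add, map_add, hx, hy, add_zero]
    | mul x y _ _ hx hy => rw [map_mul, Derivation.leibniz, hx, hy, smul_zero, smul_zero, add_zero]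
  · rw [hδ, Finset.sum_eq_single t (fun l hl hlt => by rw [hDT l hl t ht hlt.symm, mul_zero])
      (fun h => absurd ht h), div_mul_cancel₀ _ (hDt t ht)]

variable {K : Type*} [CommRing K] {n p : ℕ}

/-- Clearing denominators in a derivation of the field of fractions. -/
theorem exists_derivation_map_eq_mul [IsDomain K] {L : Type*} [Field L]
    [Algebra (MvPolynomial (Fin n) K) L] [IsFractionRing (MvPolynomial (Fin n) K) L]
    {δ : Derivation ℤ L L} (hδ : ∀ r, δ (algebraMap (MvPolynomial (Fin n) K) L (C r)) = 0) :
    ∃ (d : Derivation K (MvPolynomial (Fin n) K) (MvPolynomial (Fin n) K)) (a : L), a ≠ 0 ∧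
      ∀ h, algebraMap _ L (d h) = a * δ (algebraMap _ L h) := by
  obtain ⟨a, ha⟩ := IsLocalization.exist_integer_multiples_of_finite
    (nonZeroDivisors (MvPolynomial (Fin n) K))
    fun j => δ (algebraMap (MvPolynomial (Fin n) K) L (X j))
  choose v hv using ha
  refine ⟨mkDerivation K v, algebraMap (MvPolynomial (Fin n) K) L a, ?_, fun h => ?_⟩
  · rw [Ne, map_eq_zero_iff _ (IsFractionRing.injective (MvPolynomial (Fin n) K) L)]
    exact nonZeroDivisors.ne_zero a.2
  · have h1 : mkDerivation K v h = ∑ k, mkDerivation K v (X k) * pderiv k h :=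
      derivation_map_eq_sum (RingHom.id _) ((mkDerivation K v).restrictScalars ℤ)
        (fun r => (mkDerivation K v).map_algebraMap r) h
    rw [h1, derivation_map_eq_sum (algebraMap (MvPolynomial (Fin n) K) L) δ hδ h, map_sum,
      Finset.mul_sum]
    refine Finset.sum_congr rfl fun k _ => ?_
    rw [map_mul, mkDerivation_X, hv, Algebra.smul_def, mul_assoc]

theorem map_mem_fractionSubfield_of_X {L : Type*} [Field L] (hp : p ≠ 0)
    (hB : ∀ a : MvPolynomial (Fin n) K, a ^ p ∈ powSubalgebra K n p)
    (φ : MvPolynomial (Fin n) K →+* L)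
    {R : Subalgebra (powSubalgebra K n p) (MvPolynomial (Fin n) K)}
    (hX : ∀ j, φ (X j) ∈ fractionSubfield hp hB φ R) (h : MvPolynomial (Fin n) K) :
    φ h ∈ fractionSubfield hp hB φ R := by
  induction h using MvPolynomial.induction_on with
  | C r =>
    exact map_mem_fractionSubfield _ _ _
      (R.algebraMap_mem (algebraMap K (powSubalgebra K n p) r))
  | add P Q hP hQ =>
    rw [map_add]
    exact add_mem hP hQ
  | mul_X P i hP =>
    rw [map_mul]
    exact mul_mem hP (hX i)

end Constants

/-! ### A derivation with the prescribed ring of constants. -/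

section Existence

variable {K : Type*} [CommRing K] [IsDomain K] {n p : ℕ}

/-- A subset of the polynomial ring determines a derivation whose ring of constants consists of
the polynomials that are fractions of elements of `B[s₀]`, with denominators in `B`. -/
theorem exists_derivation_constants [CharP K p] (hp : p.Prime) (hn : 1 ≤ n)
    (s₀ : Set (MvPolynomial (Fin n) K)) :
    ∃ d : Derivation K (MvPolynomial (Fin n) K) (MvPolynomial (Fin n) K),
      (∀ h ∈ Algebra.adjoin (powSubalgebra K n p) s₀, d h = 0) ∧
      ∀ h, d h = 0 → ∃ b ∈ powSubalgebra K n p, b ≠ 0 ∧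
        b * h ∈ Algebra.adjoin (powSubalgebra K n p) s₀ := by
  classical
  obtain ⟨L, _, _, _⟩ : ∃ (L : Type _) (_ : Field L) (_ : Algebra (MvPolynomial (Fin n) K) L),
      IsFractionRing (MvPolynomial (Fin n) K) L :=
    ⟨FractionRing (MvPolynomial (Fin n) K), inferInstance, inferInstance, inferInstance⟩
  let φ : MvPolynomial (Fin n) K →+* L := algebraMap _ L
  have hφ : Function.Injective φ := IsFractionRing.injective _ L
  have hL : ∀ x : L, ∃ a b, φ b ≠ 0 ∧ φ b * x = φ a := by
    intro x
    obtain ⟨a, b, hb, rfl⟩ := IsFractionRing.div_surjective (A := MvPolynomial (Fin n) K) x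
    have hb0 : φ b ≠ 0 := fun h =>
      nonZeroDivisors.ne_zero hb (hφ (h.trans (map_zero φ).symm))
    exact ⟨a, b, hb0, mul_div_cancel₀ _ hb0⟩
  have : CharP L p := (CharP.charP_iff_prime_eq_zero hp).2 (by
    rw [← map_natCast φ, CharP.cast_eq_zero, map_zero])
  have hB : ∀ a : MvPolynomial (Fin n) K, a ^ p ∈ powSubalgebra K n p := pow_mem_powSubalgebra
  -- The eigenvalues are p-th powers, hence in B and constant, and distinct powers of one variable,
  -- so their combinations with coefficients below p are distinct.
  let c : Fin n → MvPolynomial (Fin n) K := fun t => (X ⟨0, hn⟩ ^ (t : ℕ)) ^ p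
  obtain ⟨T, δ, hT, hδR, hδX⟩ := exists_finset_derivation_eigen hp hB φ hL s₀
    (X : Fin n → MvPolynomial (Fin n) K) c
  have hδB : ∀ b ∈ powSubalgebra K n p, δ (φ b) = 0 := fun b hb =>
    hδR b (Subalgebra.algebraMap_mem _ (⟨b, hb⟩ : powSubalgebra K n p))
  obtain ⟨d, a, ha0, hd⟩ := exists_derivation_map_eq_mul (δ := δ) fun r =>
    hδB _ (Subalgebra.algebraMap_mem _ r)
  replace hd : ∀ h, φ (d h) = a * δ (φ h) := hd
  refine ⟨d, fun h hh => hφ (by rw [hd, hδR h hh, mul_zero, map_zero]), fun h hh => ?_⟩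
  have hδh : δ (φ h) = 0 := by
    have h1 := hd h
    rw [hh, map_zero] at h1
    exact (mul_eq_zero.1 h1.symm).resolve_left ha0
  obtain ⟨e, he, b, hb, hb0, hbe⟩ := map_mem_fractionSubfield_of_X hp.ne_zero hB φ hT h
  refine ⟨b, hb, fun h0 => hb0 (by rw [h0, map_zero]), ?_⟩
  have hδe : δ (φ e) = 0 := by
    rw [← hbe, Derivation.leibniz, hδB b hb, hδh, smul_zero, smul_zero, add_zero]
  have hbe' : b * h = e := hφ (by rw [map_mul, hbe])
  rw [hbe']
  have hinj := injective_sum_natCast_mul_X_pow (R := K) (p := p) hp.pos (⟨0, hn⟩ : Fin n)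
    (r := fun t : T => ((t : Fin n) : ℕ)) fun s t h => Subtype.ext (Fin.ext h)
  have hδc : ∀ t, δ (φ (c t)) = 0 := fun t => hδB _ (hB _)
  have hpA : (p : MvPolynomial (Fin n) K) = 0 := CharP.cast_eq_zero _ p
  exact mem_adjoin_of_derivation_eq_zero hp.pos hpA hB hφ hδR hδX hδc hinj he hδe

theorem exists_isPBasis_of_jacobianMinor [UniqueFactorizationMonoid K] [CharP K p] (hp : p.Prime)
    (hn : 1 ≤ n) {m : ℕ} {f : Fin m → MvPolynomial (Fin n) K}
    (hmin : ∀ g, Prime g → ¬ ∀ j, g ∣ jacobianMinor f j) :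
    ∃ d : Derivation K (MvPolynomial (Fin n) K) (MvPolynomial (Fin n) K),
      IsPBasis p (powSubalgebra K n p) (ringOfConstants d) f := by
  have hmin0 : ∃ j, jacobianMinor f j ≠ 0 := by
    by_contra hcon
    push Not at hcon
    exact hmin (X ⟨0, hn⟩) X_prime fun j => hcon j ▸ dvd_zero _
  have hdiv : ∀ b c, (∀ j, b ∣ c * jacobianMinor f j) → b ∣ c := fun b c h =>
    dvd_of_forall_dvd_mul hmin hmin0 h
  obtain ⟨d, hd, hd'⟩ := exists_derivation_constants hp hn (Set.range f)
  refine ⟨d, ?_, Set.Subset.antisymm ?_ ?_⟩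
  · rw [Fintype.linearIndependent_iff]
    intro c hc α
    have h1 := dvd_of_dvd_sum_smul hp (Subalgebra.zero_mem _) (hdiv 0) ⟨0, by rw [hc, mul_zero]⟩ α
    exact Subtype.ext (zero_dvd_iff.1 h1)
  · intro h hh
    refine hd h (?_ : h ∈ Subalgebra.toSubmodule (Algebra.adjoin _ _))
    refine Submodule.span_le.2 ?_ hh
    rintro _ ⟨α, rfl⟩
    exact Subalgebra.prod_mem _ fun i _ =>
      Subalgebra.pow_mem _ (Algebra.subset_adjoin (Set.mem_range_self i)) _
  · intro h hh
    obtain ⟨b, hb, hb0, hbh⟩ := hd' h hh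
    rw [Algebra.adjoin_range_eq_range_aeval] at hbh
    obtain ⟨Φ, hΦ⟩ := hbh
    obtain ⟨c, hc, -⟩ := exists_reduced_aeval hp.pos natCast_powSubalgebra_eq_zero
      exists_algebraMap_eq_pow f Φ
    replace hc : b * h = ∑ α, c α • ∏ i, f i ^ (α i : ℕ) := hΦ.symm.trans hc
    choose e he using dvd_of_dvd_sum_smul hp hb (hdiv b) ⟨h, hc.symm⟩
    -- Both b and b * e α have zero gradient and b ≠ 0, so e α has zero gradient too.
    have heB : ∀ α, e α ∈ powSubalgebra K n p := fun α =>
      mem_powSubalgebra_of_pderiv_eq_zero fun k => by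
        have h1 := pderiv_eq_zero_of_mem_powSubalgebra (c α).2 k
        rw [he, pderiv_mul, pderiv_eq_zero_of_mem_powSubalgebra hb k, zero_mul, zero_add] at h1
        exact (mul_eq_zero.1 h1).resolve_left hb0
    have hsum : h = ∑ α, (⟨e α, heB α⟩ : powSubalgebra K n p) • ∏ i, f i ^ (α i : ℕ) := by
      refine mul_left_cancel₀ hb0 ?_
      rw [hc, Finset.mul_sum]
      refine Finset.sum_congr rfl fun α _ => ?_
      change (c α : MvPolynomial (Fin n) K) * _ = b * (e α * _)
      rw [he, mul_assoc]
    rw [hsum]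
    exact Submodule.sum_mem _ fun α _ => Submodule.smul_mem _ _ (Submodule.subset_span ⟨α, rfl⟩)

end Existence

theorem theorem2 {K : Type*} [CommRing K] [IsDomain K] [UniqueFactorizationMonoid K]
    (p : ℕ) (hp : 0 < p) [CharP K p] {m n : ℕ} (hm : 1 ≤ m) (hmn : m ≤ n)
    (f : Fin m → MvPolynomial (Fin n) K) :
    List.TFAE [
      Associated (dgcd f) 1,
      ∃ d : Derivation K (MvPolynomial (Fin n) K) (MvPolynomial (Fin n) K),
        IsPBasis p (powSubalgebra K n p) (ringOfConstants d) f,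
      (∀ i : Fin m, ∀ b ∈ adjoinOmitting p f {i}, ∀ c ∈ adjoinOmitting p f {i},
          b ≠ 0 → IsRelPrime b c →
            Squarefree (b * f i + c) ∧ IsFreeOf (powSubalgebra K n p) (b * f i + c)) ∧
        (1 < m → ∀ i j : Fin m, i ≠ j →
          ∀ b₁ ∈ adjoinOmitting p f {i, j}, ∀ b₂ ∈ adjoinOmitting p f {i, j},
          ∀ c₁ ∈ adjoinOmitting p f {i, j}, ∀ c₂ ∈ adjoinOmitting p f {i, j},
            b₁ ≠ 0 → b₂ ≠ 0 → IsRelPrime b₁ c₁ → IsRelPrime b₂ c₂ →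
              IsRelPrime (b₁ * f i + c₁) (b₂ * f j + c₂))] := by
  have hprime : p.Prime := (CharP.char_is_prime_or_zero K p).resolve_right hp.ne'
  have hn : 1 ≤ n := hm.trans hmn
  rw [associated_dgcd_one_iff hn]
  tfae_have 1 → 2 := exists_isPBasis_of_jacobianMinor hprime hn
  tfae_have 2 → 1 := by
    rintro ⟨d, hd⟩ g hg
    exact hd.not_dvd_jacobianMinor hprime hm hg
  tfae_have 1 → 3 := fun h =>
    ⟨fun i b hb c hc _ hbc => squarefree_and_isFreeOf_of_jacobianMinor hn h hb hc hbc,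
      fun _ i j hij b₁ hb₁ b₂ hb₂ c₁ hc₁ c₂ hc₂ _ _ h₁ h₂ =>
        isRelPrime_of_jacobianMinor hn h hij hb₁ hb₂ hc₁ hc₂ h₁ h₂⟩
  tfae_have 3 → 1 := by
    rintro ⟨h₁, h₂⟩ g hg
    refine not_dvd_jacobianMinor_of_squarefree hprime hm h₁ (fun i j hij => ?_) hg
    exact h₂ (by
      have := Fin.val_ne_of_ne hij
      omega) i j hij
  tfae_finish
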